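/- **Definitions.** Let $p$ be a prime. Complexity is counted in operations $(+,-,\times)$ in $\mathbb F_p$: a program is a straight-line program over $\mathbb F_p$, and its cost is its number of arithmetic operations. A *multiplication function* for $\mathbb F_p[X]$ is a function $M:\mathbb N\to\mathbb N$ such that, for all $n\ge 1$, the product of two polynomials of degree less than $n$ over $\mathbb F_p$ can be computed by a straight-line program of cost at most $M(n)$, and such that $M(m)/m\le M(n)/n$ for $1\le m\le n$, $M(mn)\le m^2M(n)$ and $n\le M(n)$ for $m,n\ge 1$. Let $Q_0\in\mathbb F_p[X_0]$ be irreducible of degree $d$, and let $x_0=X_0\bmod Q_0$. Assume $\mathrm{Tr}_{\mathbb U_0/\mathbb F_p}(x_0)\ne 0$, where $\mathbb U_0=\mathbb F_p[X_0]/(Q_0)$. Put $G_0=X_0$, $G_1=X_1$ if $p=2$ and $d$ is odd, and $G_i=X_i^{2p-1}$ in all other cases. For $i\ge 0$ let $$\mathbb U_i=\mathbb F_p[X_0,\dots,X_i]\big/\big(Q_0(X_0),\ X_j^p-X_j-G_{j-1}\ (1\le j\le i)\big),$$ let $x_j$ be the residue class of $X_j$, and let $Q_i$ be the minimal polynomial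 of $x_i$ over $\mathbb F_p$. For $i\ge 1$ consider the families of elements of $\mathbb U_i$ $$\mathbf C_i=(x_i^a)_{0\le a<p^id},\qquad \mathbf D_i=(x_{i-1}^a x_i^b)_{0\le a<p^{i-1}d,\ 0\le b<p}.$$ They are $\mathbb F_p$-bases of $\mathbb U_i$. *Push-down* at level $i$ takes the coordinates of $v\in\mathbb U_i$ on $\mathbf C_i$ and returns its coordinates on $\mathbf D_i$; *Lift-up* is the inverse operation. Besides the coordinates of $v$, both may use as inputs, at no cost, the following precomputed elements of $\mathbb F_p$: the coefficients of $Q_{i-1}$, of $Q_i$ and of $(Q_i')^{-1}\bmod Q_i$, and the traces $\mathrm{Tr}_{\mathbb U_i/\mathbb F_p}(x_{i-1}^ax_i^b)$ of the elements of $\mathbf D_i$. **Theorem.** There is an absolute constant $K$ such that the following holds for every prime $p$, every multiplication function $M$ for $\mathbb F_p[X]$ and every $d\ge 1$. There is a function $L:\mathbb N\setminus\{0\}\to\mathbb N$ such that, for all $i\ge 1$, 1. $p\,L(i)\le L(i+1)$ and $p\,M(p^id)\le K\,L(i)$; 2. $L(i)\le K\big(p^{i+1}d\,(\log_p(p^id))^2+p\,M(p^id)\big)$;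 3. there are two straight-line programs over $\mathbb F_p$, each of cost at most $L(i)$, that depend on $p$, $d$, $i$ (and $M$) but not on $Q_0$, and that perform Push-down and Lift-up, respectively, at level $i$, for every irreducible $Q_0\in\mathbb F_p[X_0]$ of degree $d$ with $\mathrm{Tr}_{\mathbb U_0/\mathbb F_p}(x_0)\ne 0$ and all inputs $v\in\mathbb U_i$; in particular $\mathbf C_i$ and $\mathbf D_i$ are bases of $\mathbb U_i$ and the precomputed quantities exist. -/

import Mathlib

open Polynomial

namespace ASTower

/-! ### Straight-line programs and their cost -/

/-- The three arithmetic operations of a ring. -/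
inductive ArithOp where
  | add
  | sub
  | mul

/-- The value of an arithmetic operation. -/
def ArithOp.apply {K : Type} [CommRing K] : ArithOp → K → K → K
  | .add, a, b => a + b
  | .sub, a, b => a - b
  | .mul, a, b => a * b

/-- An operand of an instruction: one of the inputs (indexed by `ι`), a constant of `K`, or the
result of the instruction number `j` (counted from `0`). -/
inductive Operand (K ι : Type) where
  | input (a : ι)
  | const (c : K)
  | reg (j : ℕ)

/-- One instruction: a single arithmetic operation applied to two operands. -/
structure Instr (K ι : Type) where
  op : ArithOp
  lhs : Operand K ι
  rhs : Operand K ι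

/-- A straight-line program over `K` with inputs indexed by `ι` and outputs indexed by `κ`.
An output is a result of an instruction, an input or a constant. -/
structure SLP (K ι κ : Type) where
  code : List (Instr K ι)
  out : κ → Operand K ι

/-- The value of an operand, for the inputs `x` and the list `r` of the results computed so far
(a reference to an instruction that has not been executed reads `0`). -/
def Operand.value {K ι : Type} [CommRing K] (x : ι → K) (r : List K) : Operand K ι → K
  | .input a => x a
  | .const c => c
  | .reg j => r.getD j 0

/-- Execute a list of instructions in order, appending every result to the list of results. -/
def runCode {K ι : Type} [CommRing K] (x : ι → K) : List (Instr K ι) → List K → List K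
  | [], r => r
  | g :: l, r => runCode x l (r ++ [g.op.apply (g.lhs.value x r) (g.rhs.value x r)])

/-- The output of a straight-line program on the input `x`. -/
def SLP.eval {K ι κ : Type} [CommRing K] (P : SLP K ι κ) (x : ι → K) : κ → K :=
  fun k => (P.out k).value x (runCode x P.code [])

/-- The cost of a straight-line program: its number of arithmetic operations in `K`. -/
def SLP.cost {K ι κ : Type} (P : SLP K ι κ) : ℕ := P.code.length

/-! ### Multiplication functions -/

/-- The polynomial of degree less than `n` with the coefficients `a`. -/
noncomputable def polyOf {K : Type} [CommRing K] {n : ℕ} (a : Fin n → K) : K[X] :=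
  ∑ j : Fin n, C (a j) * X ^ (j : ℕ)

/-- `M` is a multiplication function for `K[X]`: two polynomials of degree less than `n` can be
multiplied in `M n` operations in `K`; moreover `M n / n` is nondecreasing,
`M (m * n) ≤ m ^ 2 * M n`, and `n ≤ M n`. -/
structure IsMulFunction (K : Type) [CommRing K] (M : ℕ → ℕ) : Prop where
  mul_cost : ∀ n : ℕ, 0 < n → ∃ P : SLP K (Fin n ⊕ Fin n) (Fin (2 * n - 1)),
    P.cost ≤ M n ∧
    ∀ (a b : Fin n → K) (k : Fin (2 * n - 1)),
      P.eval (Sum.elim a b) k = (polyOf a * polyOf b).coeff (k : ℕ)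
  div_mono : ∀ m n : ℕ, 0 < m → m ≤ n → M m * n ≤ M n * m
  mul_le : ∀ m n : ℕ, 0 < m → 0 < n → M (m * n) ≤ m ^ 2 * M n
  le_self : ∀ n : ℕ, 0 < n → n ≤ M n

/-! ### The tower -/

/-- The exponent `e` such that `G_i = X_i ^ e` in a tower over a base field of degree `d`. -/
def gammaExp (p d i : ℕ) : ℕ :=
  if i = 0 ∨ (i = 1 ∧ p = 2 ∧ Odd d) then 1 else 2 * p - 1

/-- The ideal `K_i` of `𝔽_p[X_0, …, X_i]` generated by `Q_0(X_0)` and by the polynomials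
`X_{j+1} ^ p - X_{j+1} - G_j` for `j < i`. -/
noncomputable def towerIdeal (p : ℕ) (Q₀ : (ZMod p)[X]) (i : ℕ) :
    Ideal (MvPolynomial (Fin (i + 1)) (ZMod p)) :=
  Ideal.span (insert (aeval (MvPolynomial.X (0 : Fin (i + 1))) Q₀)
    (Set.range fun j : Fin i =>
      (MvPolynomial.X j.succ ^ p - MvPolynomial.X j.succ
        - MvPolynomial.X j.castSucc ^ gammaExp p Q₀.natDegree (j : ℕ) :
        MvPolynomial (Fin (i + 1)) (ZMod p))))

/-- The level `U_i = 𝔽_p[X_0, …, X_i] / K_i` of the tower. -/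
abbrev Level (p : ℕ) (Q₀ : (ZMod p)[X]) (i : ℕ) : Type :=
  MvPolynomial (Fin (i + 1)) (ZMod p) ⧸ towerIdeal p Q₀ i

/-- The residue class `x_j` of `X_j` in `U_i`, for `j ≤ i`. -/
noncomputable def gen (p : ℕ) (Q₀ : (ZMod p)[X]) (i : ℕ) (j : Fin (i + 1)) : Level p Q₀ i :=
  Ideal.Quotient.mk (towerIdeal p Q₀ i) (MvPolynomial.X j)

/-- The residue class `x_i` in `U_i`. -/
noncomputable def topGen (p : ℕ) (Q₀ : (ZMod p)[X]) (i : ℕ) : Level p Q₀ i :=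
  gen p Q₀ i (Fin.last i)

/-- The residue class `x_{i-1}` in `U_i` (used for `1 ≤ i`). -/
noncomputable def prevGen (p : ℕ) (Q₀ : (ZMod p)[X]) (i : ℕ) : Level p Q₀ i :=
  gen p Q₀ i ⟨i - 1, by omega⟩

/-- The minimal polynomial `Q_i` over `𝔽_p` of `x_i`. -/
noncomputable def topMinpoly (p : ℕ) (Q₀ : (ZMod p)[X]) (i : ℕ) : (ZMod p)[X] :=
  minpoly (ZMod p) (topGen p Q₀ i)

/-! ### Precomputed quantities -/

/-- Names for the precomputed elements of `𝔽_p` that are available at level `i`, where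
`n = [U_{i-1} : 𝔽_p]` and `N = [U_i : 𝔽_p]`. -/
inductive PreIndex (p n N : ℕ) where
  /-- a coefficient of `Q_{i-1}` -/
  | lowerPoly (a : Fin n)
  /-- a coefficient of `Q_i` -/
  | upperPoly (a : Fin N)
  /-- a coefficient of the inverse of the derivative of `Q_i` modulo `Q_i` -/
  | derivInv (a : Fin N)
  /-- the trace over `𝔽_p` of an element of the bivariate basis of `U_i` -/
  | trace (a : Fin n) (b : Fin p)

/-- The family `t` consists of the precomputed quantities at level `i ≥ 1`: the coefficients of
the monic polynomials `Q_{i-1}` and `Q_i` (without the leading ones), those of the inverse of `Q_i'`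
modulo `Q_i`, and the traces over `𝔽_p` of the elements `x_{i-1} ^ a * x_i ^ b`. -/
structure IsPrecomputed (p d : ℕ) (Q₀ : (ZMod p)[X]) (i : ℕ)
    (t : PreIndex p (p ^ (i - 1) * d) (p ^ i * d) → ZMod p) : Prop where
  lowerPoly : ∀ a, t (.lowerPoly a) = (topMinpoly p Q₀ (i - 1)).coeff (a : ℕ)
  upperPoly : ∀ a, t (.upperPoly a) = (topMinpoly p Q₀ i).coeff (a : ℕ)
  derivInv : topMinpoly p Q₀ i ∣
    polyOf (fun a => t (.derivInv a)) * derivative (topMinpoly p Q₀ i) - 1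
  trace : ∀ a b, t (.trace a b) =
    Algebra.trace (ZMod p) (Level p Q₀ i) (prevGen p Q₀ i ^ (a : ℕ) * topGen p Q₀ i ^ (b : ℕ))

end ASTower

/-! Write y = x_{i-1}, x = x_i and z = y^e with e = `gammaExp p d (i - 1)`, so that x^p - x = z; let
n be the degree of U_{i-1} and N = pn. If f = ∑_b X^b W_b(X^p - X), then f(x) = ∑_b W_b(z) x^b. So
both conversions combine a base change between f and its digits W_b with a change of generator
between z and y inside U_{i-1}.

Base change. In characteristic p, (X^p - X)^(p^k) = X^(p^(k+1)) - X^(p^k) has only two terms, so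
dividing by it takes no multiplications, and divide and conquer costs O(p N log_p N) operations
(`exists_baseEval_eq`, `derives_baseEval`).

Change of generator. Passing from z to y is the substitution X ↦ X^e, with e < 2p, followed by
reduction modulo Q = Q_{i-1}. Passing from y to z is harder (`IsGeneratorChange.aeval_eq`). The
traces Tr(w y^k) are the coefficients of the rational series rev(w Q' mod Q) / rev(Q)
(`X_pow_dvd_power_projection`). Every e-th of them is a Tr(w z^k). Euler's dual basis formula
(`mul_aeval_derivative_minpoly`) turns these into w P'(z), where P is the minimal polynomial of z,
and it remains to divide by P'(z). Since Q_i = P(X^p - X) and Q_i' = -P'(X^p - X), both P and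
-1/P'(z) are read off the zeroth digits of Q_i and of the inverse of Q_i'. With Newton inversion
each of the p digits costs O(M(N)).

Field theory. By induction on the level (`IsLevelField.exists_succ`), U_i is a finite field in which
G_i(x_i) generates over 𝔽_p and has nonzero trace; the nonzero trace makes the next Artin–Schreier
polynomial irreducible.

Uniformity in Q_0. The computation takes place in the ring R of all functions of the inputs, where
the Q's become monic polynomials with variable coefficients. `Derives` counts operations in R and
translates into a program. The results are characterized by relations that ring homomorphisms
preserve (`IsGeneratorChange.map`, `IsLiftUp.map`), so they specialize at the actual input, where
the field theory applies. -/

namespace ASTower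

/-! ### Computations with elements of an algebra -/

/-- `Derives K S c T`: starting from the elements of `S` and the constants of `K`, all elements
of `T` are obtained in at most `c` arithmetic operations. -/
inductive Derives (K : Type) {R : Type} [CommRing K] [CommRing R] [Algebra K R] :
    Set R → ℕ → Set R → Prop
  | done {S T : Set R} {c : ℕ} (h : T ⊆ S ∪ Set.range (algebraMap K R)) : Derives K S c T
  | step {S T : Set R} {c : ℕ} {a b : R} (op : ArithOp)
      (ha : a ∈ S ∪ Set.range (algebraMap K R)) (hb : b ∈ S ∪ Set.range (algebraMap K R))
      (h : Derives K (insert (op.apply a b) S) c T) : Derives K S (c + 1) T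

namespace Derives

variable {K R : Type} [CommRing K] [CommRing R] [Algebra K R] {S S' T T' U : Set R} {c c' : ℕ}

theorem mono_left (h : Derives K S c T) (hS : S ⊆ S' ∪ Set.range (algebraMap K R)) :
    Derives K S' c T := by
  induction h generalizing S' with
  | done h => exact .done (h.trans (Set.union_subset hS Set.subset_union_right))
  | step op ha hb _ ih =>
    refine .step op (Set.union_subset hS Set.subset_union_right ha)
      (Set.union_subset hS Set.subset_union_right hb) (ih ?_)
    · refine Set.insert_subset (Or.inl (Set.mem_insert _ _)) (hS.trans ?_)
      exact Set.union_subset_union_left _ (Set.subset_insert _ _)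

theorem mono_right (h : Derives K S c T) (hT : T' ⊆ T ∪ Set.range (algebraMap K R)) :
    Derives K S c T' := by
  induction h with
  | done h => exact .done (hT.trans (Set.union_subset h Set.subset_union_right))
  | step op ha hb _ ih => exact .step op ha hb (ih hT)

theorem mono_cost (h : Derives K S c T) (hc : c ≤ c') : Derives K S c' T := by
  induction h generalizing c' with
  | done h => exact .done h
  | step op ha hb _ ih =>
    obtain ⟨k, rfl⟩ : ∃ k, c' = k + 1 := ⟨c' - 1, by omega⟩
    exact .step op ha hb (ih (by omega))

theorem keep (h : Derives K S c T) : Derives K S c (S ∪ T) := by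
  induction h with
  | done h => exact .done (Set.union_subset Set.subset_union_left h)
  | step op ha hb _ ih =>
    refine .step op ha hb (ih.mono_right ?_)
    intro x hx
    rcases hx with hx | hx
    · exact Or.inl (Or.inl (Or.inr hx))
    · exact Or.inl (Or.inr hx)

theorem trans (h : Derives K S c T) (h' : Derives K T c' U) : Derives K S (c + c') U := by
  induction h with
  | done h => exact (h'.mono_left h).mono_cost (by omega)
  | step op ha hb _ ih => rw [Nat.add_right_comm]; exact .step op ha hb (ih h')

theorem trans' (h : Derives K S c T) (h' : Derives K T' c' U)
    (hT : T' ⊆ S ∪ T ∪ Set.range (algebraMap K R)) : Derives K S (c + c') U :=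
  h.keep.trans (h'.mono_left hT)

theorem union (h : Derives K S c T) (h' : Derives K S c' T') : Derives K S (c + c') (T ∪ T') := by
  refine (h.keep.trans (h'.mono_left (S' := S ∪ T) ?_).keep).mono_right ?_
  · exact fun x hx => Or.inl (Or.inl hx)
  · rintro x (hx | hx)
    · exact Or.inl (Or.inl (Or.inr hx))
    · exact Or.inl (Or.inr hx)

theorem iUnion_lt (m : ℕ) (T : ℕ → Set R) (h : ∀ b < m, Derives K S c (T b)) :
    Derives K S (m * c) (⋃ b, ⋃ (_ : b < m), T b) := by
  induction m with
  | zero => exact .done (by simp)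
  | succ m ih =>
    have := (ih fun b hb => h b (by omega)).union (h m (by omega))
    rw [← Nat.succ_mul] at this
    refine this.mono_right fun x hx => ?_
    simp only [Set.mem_iUnion] at hx
    obtain ⟨b, hb, hx⟩ := hx
    rcases Nat.lt_succ_iff_lt_or_eq.1 hb with hb | rfl
    · exact Or.inl (Or.inl (by simp only [Set.mem_iUnion]; exact ⟨b, hb, hx⟩))
    · exact Or.inl (Or.inr hx)

theorem ops (n : ℕ) (u : ℕ → R) (h : ∀ k < n, ∃ op : ArithOp, ∃ a b : R,
    a ∈ S ∪ Set.range (algebraMap K R) ∧ b ∈ S ∪ Set.range (algebraMap K R) ∧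
      u k = op.apply a b) : Derives K S n (u '' Set.Iio n) := by
  have := iUnion_lt (K := K) (S := S) (c := 1) n (fun k => {u k}) fun k hk => by
    obtain ⟨op, a, b, ha, hb, he⟩ := h k hk
    exact .step op ha hb (.done (by simp [he]))
  rw [mul_one] at this
  refine this.mono_right ?_
  rintro _ ⟨k, hk, rfl⟩
  exact Or.inl (by simp only [Set.mem_iUnion]; exact ⟨k, hk, rfl⟩)

end Derives

/-! ### Straight-line programs and derivations -/

section Programs

variable {K ι κ ι' : Type} [CommRing K]

theorem ArithOp.apply_pi (op : ArithOp) (a b : (ι → K) → K) (x : ι → K) :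
    op.apply a b x = op.apply (a x) (b x) := by
  cases op <;> rfl

/-- An operand represents the function `s` when the registers contain the functions in `r`. -/
def Represents (r : List ((ι → K) → K)) (o : Operand K ι) (s : (ι → K) → K) : Prop :=
  ∀ (x : ι → K) (r' : List K), o.value x (r.map (· x) ++ r') = s x

theorem Represents.append {r : List ((ι → K) → K)} {o : Operand K ι} {s : (ι → K) → K}
    (h : Represents r o s) (a : (ι → K) → K) : Represents (r ++ [a]) o s := by
  intro x r'
  simpa using h x (a x :: r')

theorem represents_last (r : List ((ι → K) → K)) (a : (ι → K) → K) :
    Represents (r ++ [a]) (.reg r.length) a := by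
  intro x r'
  simp [Operand.value]

theorem represents_of_mem {r : List ((ι → K) → K)} {S : Set ((ι → K) → K)}
    (hS : ∀ s ∈ S, ∃ o, Represents r o s) {s : (ι → K) → K}
    (hs : s ∈ S ∪ Set.range (algebraMap K ((ι → K) → K))) : ∃ o, Represents r o s := by
  rcases hs with hs | ⟨c, rfl⟩
  · exact hS s hs
  · exact ⟨.const c, fun x r' => rfl⟩

/-- Each derivation step becomes one instruction. Operands found earlier stay valid because results
are only ever appended to the register list. -/
theorem Derives.exists_code {S T : Set ((ι → K) → K)} {c : ℕ} (h : Derives K S c T)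
    (r : List ((ι → K) → K)) (hS : ∀ s ∈ S, ∃ o, Represents r o s) :
    ∃ code : List (Instr K ι), code.length ≤ c ∧ ∀ t ∈ T, ∃ o : Operand K ι,
      ∀ x, o.value x (runCode x code (r.map (· x))) = t x := by
  induction h generalizing r with
  | done h =>
    refine ⟨[], by simp, fun t ht => ?_⟩
    obtain ⟨o, ho⟩ := represents_of_mem hS (h ht)
    exact ⟨o, fun x => by simpa [runCode] using ho x []⟩
  | @step S T c a b op ha hb _ ih =>
    obtain ⟨oa, hoa⟩ := represents_of_mem hS ha
    obtain ⟨ob, hob⟩ := represents_of_mem hS hb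
    obtain ⟨code, hl, hcode⟩ := ih (r ++ [op.apply a b]) (by
      rintro s (rfl | hs)
      · exact ⟨_, represents_last _ _⟩
      · obtain ⟨o, ho⟩ := hS s hs
        exact ⟨o, ho.append _⟩)
    refine ⟨⟨op, oa, ob⟩ :: code, by simpa using hl, fun t ht => ?_⟩
    obtain ⟨o, ho⟩ := hcode t ht
    refine ⟨o, fun x => ?_⟩
    have h1 := hoa x []
    have h2 := hob x []
    rw [List.append_nil] at h1 h2
    rw [← ho x, runCode, h1, h2, List.map_append]
    simp [ArithOp.apply_pi]

theorem Derives.exists_program {c : ℕ} (f : κ → (ι → K) → K)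
    (h : Derives K (Set.range fun (i : ι) (x : ι → K) => x i) c (Set.range f)) :
    ∃ P : SLP K ι κ, P.cost ≤ c ∧ ∀ x k, P.eval x k = f k x := by
  obtain ⟨code, hl, hcode⟩ := h.exists_code [] (by
    rintro _ ⟨i, rfl⟩
    exact ⟨.input i, fun x r' => rfl⟩)
  choose o ho using fun k => hcode (f k) ⟨k, rfl⟩
  exact ⟨⟨code, o⟩, hl, fun x k => ho k x⟩

/-- Running a program on functions of the input instead of scalars; this is how the given
multiplication programs become subroutines of a derivation. -/
theorem derives_of_code (a : ι' → (ι → K) → K) (code : List (Instr K ι'))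
    (r : List ((ι → K) → K)) (S : Set ((ι → K) → K)) (ha : ∀ i, a i ∈ S)
    (hr : ∀ s ∈ r, s ∈ S) (o : κ → Operand K ι') :
    Derives K S code.length (Set.range fun (k : κ) (x : ι → K) =>
      (o k).value (fun i => a i x) (runCode (fun i => a i x) code (r.map (· x)))) := by
  have key : ∀ (r : List ((ι → K) → K)) (S : Set ((ι → K) → K)), (∀ i, a i ∈ S) →
      (∀ s ∈ r, s ∈ S) → ∀ o : Operand K ι',
      (fun x : ι → K => o.value (fun i => a i x) (r.map (· x))) ∈
        S ∪ Set.range (algebraMap K ((ι → K) → K)) := by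
    intro r S ha hr o
    cases o with
    | input i => exact Or.inl (ha i)
    | const c => exact Or.inr ⟨c, rfl⟩
    | reg j =>
      by_cases hj : j < r.length
      · refine Or.inl (hr _ (List.getElem_mem hj) |> fun h => ?_)
        convert h using 1
        funext x
        simp [Operand.value, hj]
      -- A reference past the end reads the default 0, which is a constant and hence free.
      · refine Or.inr ⟨0, ?_⟩
        funext x
        simp [Operand.value, hj]
  induction code generalizing r S with
  | nil =>
    refine .done ?_
    rintro _ ⟨k, rfl⟩
    exact key r S ha hr (o k)
  | cons g l ih =>
    refine .step g.op (key r S ha hr g.lhs) (key r S ha hr g.rhs) ?_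
    let v : (ι → K) → K := g.op.apply (fun x => g.lhs.value (fun i => a i x) (r.map (· x)))
        (fun x => g.rhs.value (fun i => a i x) (r.map (· x)))
    have := ih (r ++ [v]) (insert v S) (fun i => Or.inr (ha i)) ?_
    swap
    · intro s hs
      rcases List.mem_append.1 hs with hs | hs
      · exact Or.inr (hr s hs)
      · exact Or.inl (by simpa using hs)
    · refine this.mono_right (Set.Subset.trans (Eq.subset ?_) Set.subset_union_left)
      congr 1
      funext k x
      simp [runCode, ArithOp.apply_pi, v]

theorem SLP.derives (P : SLP K ι' κ) (a : ι' → (ι → K) → K) :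
    Derives K (Set.range a) P.cost (Set.range fun k x => P.eval (fun i => a i x) k) :=
  derives_of_code a P.code [] (Set.range a) (fun i => ⟨i, rfl⟩) (by simp) P.out

end Programs

/-! ### Polynomials with prescribed coefficients -/

section OfCoeffs

variable {R : Type} [CommRing R]

/-- The polynomial of degree less than `n` with coefficients `u 0, …, u (n - 1)`. -/
noncomputable def ofCoeffs (n : ℕ) (u : ℕ → R) : R[X] :=
  ∑ j ∈ Finset.range n, monomial j (u j)

theorem coeff_ofCoeffs (n : ℕ) (u : ℕ → R) (k : ℕ) :
    (ofCoeffs n u).coeff k = if k < n then u k else 0 := by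
  simp [ofCoeffs, finsetSum_coeff, coeff_monomial]

theorem degree_ofCoeffs_lt (n : ℕ) (u : ℕ → R) : (ofCoeffs n u).degree < n := by
  rw [degree_lt_iff_coeff_zero]
  intro k hk
  rw [coeff_ofCoeffs, if_neg (by omega)]

theorem map_ofCoeffs {S : Type} [CommRing S] (φ : R →+* S) (n : ℕ) (u : ℕ → R) :
    (ofCoeffs n u).map φ = ofCoeffs n fun k => φ (u k) := by
  simp [ofCoeffs, Polynomial.map_sum]

theorem X_pow_dvd_sub_ofCoeffs (n : ℕ) (f : R[X]) : X ^ n ∣ f - ofCoeffs n f.coeff := by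
  rw [X_pow_dvd_iff]
  intro k hk
  rw [coeff_sub, coeff_ofCoeffs, if_pos hk, sub_self]

theorem ofCoeffs_coeff_of_degree_lt {n : ℕ} {f : R[X]} (hf : f.degree < n) :
    ofCoeffs n f.coeff = f := by
  ext k
  rw [coeff_ofCoeffs]
  split_ifs with h
  · rfl
  · exact ((degree_lt_iff_coeff_zero f n).1 hf k (by omega)).symm

theorem eq_ofCoeffs_of_X_pow_dvd_sub {n : ℕ} {f g : R[X]} (hf : f.degree < n)
    (h : X ^ n ∣ f - g) : f = ofCoeffs n g.coeff := by
  ext k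
  rw [coeff_ofCoeffs]
  split_ifs with hk
  · have := X_pow_dvd_iff.1 h k hk
    rwa [coeff_sub, sub_eq_zero] at this
  · exact (degree_lt_iff_coeff_zero f n).1 hf k (by omega)

theorem degree_lt_of_degree_lt {f : R[X]} {m n : ℕ} (h : f.degree < m) (hmn : m ≤ n) :
    f.degree < n :=
  h.trans_le (by exact_mod_cast hmn)

theorem natDegree_lt_of_degree_lt {f : R[X]} {n : ℕ} (hn : 0 < n) (h : f.degree < n) :
    f.natDegree < n := by
  rcases eq_or_ne f 0 with rfl | hf
  · simpa using hn
  · exact (natDegree_lt_iff_degree_lt hf).2 h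

theorem degree_reflect_lt {f : R[X]} {m n : ℕ} (h : f.degree < n) (hmn : m < n) :
    (reflect m f).degree < n := by
  rw [degree_lt_iff_coeff_zero] at h ⊢
  intro k hk
  rw [coeff_reflect, revAt_eq_self_of_lt (by omega)]
  exact h k hk

end OfCoeffs

/-! ### Coefficient sets -/

section CoeffSet

variable {K R : Type} [CommRing K] [CommRing R] [Algebra K R]

/-- The set of the coefficients of a polynomial. -/
def coeffSet (f : R[X]) : Set R := Set.range f.coeff

theorem coeffSet_subset_iff {f : R[X]} {S : Set R} : coeffSet f ⊆ S ↔ ∀ k, f.coeff k ∈ S := by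
  simp [coeffSet, Set.range_subset_iff]

theorem coeff_mem_coeffSet (f : R[X]) (k : ℕ) : f.coeff k ∈ coeffSet f := ⟨k, rfl⟩

theorem zero_mem_union_range (S : Set R) : (0 : R) ∈ S ∪ Set.range (algebraMap K R) :=
  Or.inr ⟨0, map_zero _⟩

theorem one_mem_union_range (S : Set R) : (1 : R) ∈ S ∪ Set.range (algebraMap K R) :=
  Or.inr ⟨1, map_one _⟩

theorem coeffSet_ofCoeffs_subset {S : Set R} {n : ℕ} {u : ℕ → R}
    (h : ∀ k < n, u k ∈ S ∪ Set.range (algebraMap K R)) :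
    coeffSet (ofCoeffs n u) ⊆ S ∪ Set.range (algebraMap K R) := by
  rw [coeffSet_subset_iff]
  intro k
  rw [coeff_ofCoeffs]
  split_ifs with hk
  · exact h k hk
  · exact zero_mem_union_range S

theorem coeffSet_truncation_subset (n : ℕ) (f : R[X]) :
    coeffSet (ofCoeffs n f.coeff) ⊆ coeffSet f ∪ Set.range (algebraMap K R) :=
  coeffSet_ofCoeffs_subset fun k _ => Or.inl (coeff_mem_coeffSet f k)

theorem coeffSet_reflect_subset (n : ℕ) (f : R[X]) : coeffSet (reflect n f) ⊆ coeffSet f := by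
  rw [coeffSet_subset_iff]
  intro k
  rw [coeff_reflect]
  exact coeff_mem_coeffSet _ _

theorem derives_coeffSet {S : Set R} {f : R[X]} {n : ℕ} (hf : f.degree < n)
    (h : ∀ k < n, ∃ op : ArithOp, ∃ a b : R, a ∈ S ∪ Set.range (algebraMap K R) ∧
      b ∈ S ∪ Set.range (algebraMap K R) ∧ f.coeff k = op.apply a b) :
    Derives K S n (coeffSet f) := by
  refine (Derives.ops n f.coeff h).mono_right ?_
  rw [coeffSet_subset_iff]
  intro k
  by_cases hk : k < n
  · exact Or.inl ⟨k, hk, rfl⟩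
  · rw [(degree_lt_iff_coeff_zero f n).1 hf k (by omega)]
    exact zero_mem_union_range _

theorem derives_add {f g : R[X]} {n : ℕ} (hf : f.degree < n) (hg : g.degree < n) :
    Derives K (coeffSet f ∪ coeffSet g) n (coeffSet (f + g)) :=
  derives_coeffSet ((degree_add_le f g).trans_lt (max_lt hf hg)) fun k _ =>
    ⟨.add, f.coeff k, g.coeff k, Or.inl (Or.inl ⟨k, rfl⟩), Or.inl (Or.inr ⟨k, rfl⟩), coeff_add _ _ _⟩

theorem derives_sub {f g : R[X]} {n : ℕ} (hf : f.degree < n) (hg : g.degree < n) :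
    Derives K (coeffSet f ∪ coeffSet g) n (coeffSet (f - g)) :=
  derives_coeffSet ((degree_sub_le f g).trans_lt (max_lt hf hg)) fun k _ =>
    ⟨.sub, f.coeff k, g.coeff k, Or.inl (Or.inl ⟨k, rfl⟩), Or.inl (Or.inr ⟨k, rfl⟩), coeff_sub _ _ _⟩

theorem derives_neg {f : R[X]} {n : ℕ} (hf : f.degree < n) :
    Derives K (coeffSet f) n (coeffSet (-f)) :=
  derives_coeffSet (by rwa [degree_neg]) fun k _ =>
    ⟨.sub, 0, f.coeff k, zero_mem_union_range _, Or.inl ⟨k, rfl⟩, by simp [ArithOp.apply]⟩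

theorem derives_derivative {f : R[X]} {n : ℕ} (hf : f.natDegree ≤ n) :
    Derives K (coeffSet f) n (coeffSet (derivative f)) := by
  refine derives_coeffSet ?_ fun k _ =>
    ⟨.mul, f.coeff (k + 1), algebraMap K R (k + 1), Or.inl ⟨_, rfl⟩, Or.inr ⟨_, rfl⟩, ?_⟩
  · rw [degree_lt_iff_coeff_zero]
    intro k hk
    rw [coeff_derivative, coeff_eq_zero_of_natDegree_lt (by omega), zero_mul]
  · simp [coeff_derivative, ArithOp.apply]

end CoeffSet

/-! ### Fast polynomial arithmetic -/

/-- Two polynomials of degree less than `n` over the algebra `R` can be multiplied in `M n`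
operations, and `M` grows regularly. -/
structure MulCost (K R : Type) [CommRing K] [CommRing R] [Algebra K R] (M : ℕ → ℕ) : Prop where
  derives_mul : ∀ {n : ℕ} {f g : R[X]}, 0 < n → f.degree < n → g.degree < n →
    Derives K (coeffSet f ∪ coeffSet g) (M n) (coeffSet (f * g))
  div_mono : ∀ m n : ℕ, 0 < m → m ≤ n → M m * n ≤ M n * m
  mul_le : ∀ m n : ℕ, 0 < m → 0 < n → M (m * n) ≤ m ^ 2 * M n
  le_self : ∀ n : ℕ, 0 < n → n ≤ M n

theorem polyOf_coeff_eq {K : Type} [CommRing K] {n : ℕ} {f : K[X]} (hf : f.degree < n) :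
    polyOf (fun j : Fin n => f.coeff j) = f := by
  conv_rhs => rw [← ofCoeffs_coeff_of_degree_lt hf]
  rw [polyOf, ofCoeffs, ← Fin.sum_univ_eq_sum_range (fun j => monomial j (f.coeff j)) n]
  simp [C_mul_X_pow_eq_monomial]

/-- The multiplication program is only known to be correct for scalars, but an identity in a ring of
functions can be checked at every point. -/
theorem IsMulFunction.mulCost {K ι : Type} [CommRing K] {M : ℕ → ℕ} (hM : IsMulFunction K M) :
    MulCost K ((ι → K) → K) M where
  div_mono := hM.div_mono
  mul_le := hM.mul_le
  le_self := hM.le_self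
  derives_mul {n f g} hn hf hg := by
    obtain ⟨P, hc, hP⟩ := hM.mul_cost n hn
    have := (P.derives (Sum.elim (fun j => f.coeff j) (fun j => g.coeff j))).mono_cost hc
    refine (this.mono_right ?_).mono_left ?_
    · rw [coeffSet_subset_iff]
      intro k
      by_cases hk : k < 2 * n - 1
      · refine Or.inl ⟨⟨k, hk⟩, ?_⟩
        funext x
        let ev : ((ι → K) → K) →+* K := Pi.evalRingHom _ x
        have h1 : ∀ f : ((ι → K) → K)[X], f.degree < n →
            polyOf (fun j : Fin n => f.coeff j x) = f.map ev := by
          intro f hf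
          rw [← polyOf_coeff_eq (degree_map_le.trans_lt hf : (f.map ev).degree < n)]
          simp [ev]
        have h2 : (f * g).coeff k x = ((f * g).map ev).coeff k := by
          rw [coeff_map]; rfl
        rw [h2, Polynomial.map_mul, ← h1 f hf, ← h1 g hg, ← hP _ _ ⟨k, hk⟩]
        change P.eval _ _ = P.eval _ _
        congr 1
        funext i
        rcases i with i | i <;> rfl
      -- The program has 2n - 1 outputs; the remaining coefficients vanish for degree reasons.
      · have : (f * g).coeff k = 0 := by
          rcases eq_or_ne f 0 with rfl | hf0
          · simp
          rcases eq_or_ne g 0 with rfl | hg0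
          · simp
          rw [degree_eq_natDegree hf0] at hf
          rw [degree_eq_natDegree hg0] at hg
          have hf' : f.natDegree < n := by exact_mod_cast hf
          have hg' : g.natDegree < n := by exact_mod_cast hg
          refine coeff_eq_zero_of_natDegree_lt (natDegree_mul_le.trans_lt ?_)
          omega
        rw [this]
        exact zero_mem_union_range _
    · rintro _ ⟨i | i, rfl⟩
      · exact Or.inl (Or.inl ⟨_, rfl⟩)
      · exact Or.inl (Or.inr ⟨_, rfl⟩)

/-! ### Newton inversion, power series division, division with remainder. -/

namespace MulCost

variable {K R : Type} [CommRing K] [CommRing R] [Algebra K R] {M : ℕ → ℕ}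

theorem mono (hM : MulCost K R M) {m n : ℕ} (hm : 0 < m) (h : m ≤ n) : M m ≤ M n := by
  have h1 := hM.div_mono m n hm h
  have h2 : M n * m ≤ M n * n := Nat.mul_le_mul_left _ h
  exact Nat.le_of_mul_le_mul_right (h1.trans h2) (by omega)

theorem mul_le_apply (hM : MulCost K R M) {m k : ℕ} (hm : 0 < m) (hk : 0 < k) :
    k * M m ≤ M (k * m) := by
  have h1 := hM.div_mono m (k * m) hm (Nat.le_mul_of_pos_left _ hk)
  refine Nat.le_of_mul_le_mul_right ?_ hm
  calc k * M m * m = M m * (k * m) := by ring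
    _ ≤ _ := h1

/-- Newton iteration g ↦ 2g - f g², doubling the precision m. The constant 8 reproduces itself: 8
M(m) ≤ 4 M(2m), two products cost 2 M(2m), and an addition and a subtraction cost 4m ≤ 2 M(2m). -/
theorem exists_inverse_two_pow (hM : MulCost K R M) {f : R[X]} (h0 : f.coeff 0 = 1) (k : ℕ) :
    ∃ g : R[X], g.degree < (2 ^ k : ℕ) ∧ X ^ 2 ^ k ∣ f * g - 1 ∧
      Derives K (coeffSet f) (8 * M (2 ^ k)) (coeffSet g) := by
  induction k with
  | zero =>
    refine ⟨1, degree_one_le.trans_lt (by simp), ?_, .done ?_⟩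
    · rw [X_pow_dvd_iff]
      intro j hj
      obtain rfl : j = 0 := by simpa using hj
      simp [h0]
    · rw [coeffSet_subset_iff]
      intro j
      rw [coeff_one]
      split_ifs
      · exact one_mem_union_range _
      · exact zero_mem_union_range _
  | succ k ih =>
    obtain ⟨g, hg, ⟨e, he⟩, hd⟩ := ih
    set m := 2 ^ k with hm
    have hm0 : 0 < m := by positivity
    have hpow : 2 ^ (k + 1) = 2 * m := by rw [hm, pow_succ, mul_comm]
    have hX : (X : R[X]) ^ (2 * m) = X ^ m * X ^ m := by rw [← pow_add, two_mul]
    rw [hpow]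
    have hg2 : g.degree < (2 * m : ℕ) := degree_lt_of_degree_lt hg (by omega)
    obtain ⟨a, ha⟩ := X_pow_dvd_sub_ofCoeffs (2 * m) f
    have hf1 := degree_ofCoeffs_lt (2 * m) f.coeff
    have sf1 := coeffSet_truncation_subset (K := K) (2 * m) f
    set f1 := ofCoeffs (2 * m) f.coeff
    obtain ⟨b, hb⟩ := X_pow_dvd_sub_ofCoeffs (2 * m) (f1 * g)
    have hv := degree_ofCoeffs_lt (2 * m) (f1 * g).coeff
    have sv := coeffSet_truncation_subset (K := K) (2 * m) (f1 * g)
    set v := ofCoeffs (2 * m) (f1 * g).coeff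
    obtain ⟨c, hc⟩ := X_pow_dvd_sub_ofCoeffs (2 * m) (v * g)
    have hw := degree_ofCoeffs_lt (2 * m) (v * g).coeff
    have sw := coeffSet_truncation_subset (K := K) (2 * m) (v * g)
    set w := ofCoeffs (2 * m) (v * g).coeff
    have hgg : (g + g).degree < (2 * m : ℕ) := (degree_add_le _ _).trans_lt (max_lt hg2 hg2)
    -- If f g = 1 + X^m e, then f (2g - f g²) - 1 = -X^(2m) e². The terms with a, b, c come from the
    -- truncations of f, of f1 * g and of v * g.
    refine ⟨g + g - w, (degree_sub_le _ _).trans_lt (max_lt hgg hw),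
      ⟨-(e * e) + f * (a * g * g + b * g + c), ?_⟩, ?_⟩
    · have h1 : f1 = f - X ^ (2 * m) * a := by rw [← ha]; ring
      have h2 : v = f1 * g - X ^ (2 * m) * b := by rw [← hb]; ring
      have h3 : w = v * g - X ^ (2 * m) * c := by rw [← hc]; ring
      rw [h3, h2, h1]
      have he' : f * g = X ^ m * e + 1 := by rw [← he]; ring
      rw [hX]
      linear_combination (-(f * g) + 1 - X ^ m * e) * he'
    · have d1 : Derives K (coeffSet f) (8 * M m) (coeffSet f ∪ coeffSet g) := hd.keep
      have d2 : Derives K (coeffSet f) (8 * M m + M (2 * m))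
          (coeffSet f ∪ coeffSet g ∪ coeffSet (f1 * g)) := by
        refine d1.trans (Derives.keep ?_)
        refine (hM.derives_mul (by omega) hf1 hg2).mono_left (Set.union_subset ?_ ?_)
        · exact sf1.trans (by intro x hx; simp only [Set.mem_union] at hx ⊢; tauto)
        · intro x hx; simp only [Set.mem_union]; tauto
      have d3 : Derives K (coeffSet f) (8 * M m + M (2 * m) + M (2 * m))
          (coeffSet g ∪ coeffSet w) := by
        refine d2.trans ?_
        refine ((hM.derives_mul (by omega) hv hg2).mono_left (S' := coeffSet f ∪ coeffSet g ∪
          coeffSet (f1 * g)) (Set.union_subset ?_ ?_)).keep.mono_right (Set.union_subset ?_ ?_)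
        · exact sv.trans (by intro x hx; simp only [Set.mem_union] at hx ⊢; tauto)
        · intro x hx; simp only [Set.mem_union]; tauto
        · intro x hx; simp only [Set.mem_union]; tauto
        · exact sw.trans (by intro x hx; simp only [Set.mem_union] at hx ⊢; tauto)
      have d4 := (d3.trans ((derives_add hg2 hg2).mono_left (S' := coeffSet g ∪ coeffSet w)
        (by intro x hx; simp only [Set.mem_union] at hx ⊢; tauto)).keep).trans
        ((derives_sub hgg hw).mono_left (by intro x hx; simp only [Set.mem_union] at hx ⊢; tauto))
      refine d4.mono_cost ?_
      have := hM.mul_le_apply hm0 (k := 2) (by omega)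
      have := hM.le_self (2 * m) (by omega)
      omega

/-- Round m up to a power of two that is at most 2m; then M(2m) ≤ 4 M(m) gives 32 = 8 · 4. -/
theorem exists_inverse (hM : MulCost K R M) {f : R[X]} (h0 : f.coeff 0 = 1) {m : ℕ} (hm : 0 < m) :
    ∃ g : R[X], g.degree < m ∧ X ^ m ∣ f * g - 1 ∧
      Derives K (coeffSet f) (32 * M m) (coeffSet g) := by
  obtain ⟨g, -, hdvd, hd⟩ := hM.exists_inverse_two_pow h0 (Nat.log 2 m + 1)
  have h1 : m < 2 ^ (Nat.log 2 m + 1) := Nat.lt_pow_succ_log_self (by omega) m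
  have h2 : 2 ^ Nat.log 2 m ≤ m := Nat.pow_log_le_self 2 (by omega)
  refine ⟨ofCoeffs m g.coeff, degree_ofCoeffs_lt _ _, ?_, ?_⟩
  · have h3 : f * ofCoeffs m g.coeff - 1 = (f * g - 1) - f * (g - ofCoeffs m g.coeff) := by ring
    rw [h3]
    exact dvd_sub ((pow_dvd_pow X h1.le).trans hdvd)
      (Dvd.dvd.mul_left (X_pow_dvd_sub_ofCoeffs _ _) _)
  · refine (hd.mono_right (coeffSet_truncation_subset m g)).mono_cost ?_
    have h3 : M (2 ^ (Nat.log 2 m + 1)) ≤ M (2 * m) := hM.mono (by positivity) (by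
      rw [pow_succ]; omega)
    have h4 := hM.mul_le 2 m (by omega) hm
    omega

theorem derives_series_div (hM : MulCost K R M) {f q : R[X]} (hq : q.coeff 0 = 1) {m L : ℕ}
    (hm : 0 < m) (hmL : m ≤ L) (hf : f.degree < L) :
    ∃ t : R[X], t.degree < m ∧ X ^ m ∣ q * t - f ∧
      Derives K (coeffSet f ∪ coeffSet q) (33 * M L) (coeffSet t) := by
  obtain ⟨g, hg, hdvd, hd⟩ := hM.exists_inverse hq hm
  refine ⟨ofCoeffs m (g * f).coeff, degree_ofCoeffs_lt _ _, ?_, ?_⟩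
  · have h3 : q * ofCoeffs m (g * f).coeff - f =
        (q * g - 1) * f - q * (g * f - ofCoeffs m (g * f).coeff) := by ring
    rw [h3]
    exact dvd_sub (Dvd.dvd.mul_right hdvd _) (Dvd.dvd.mul_left (X_pow_dvd_sub_ofCoeffs _ _) _)
  · have d1 : Derives K (coeffSet f ∪ coeffSet q) (32 * M m) (coeffSet g) :=
      hd.mono_left fun x hx => Or.inl (Or.inr hx)
    have d2 := (d1.trans' (hM.derives_mul (by omega) (degree_lt_of_degree_lt hg hmL) hf)
      (by intro x hx; simp only [Set.mem_union] at hx ⊢; tauto)).mono_right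
        (coeffSet_truncation_subset m _)
    refine d2.mono_cost ?_
    have := hM.mono hm hmL
    omega

/-- Reversing f = Q q + r makes the remainder divisible by X^(m+1), so the reversed quotient is the
truncated series rev(f) / rev(Q). One product and one subtraction then give r. -/
theorem derives_modByMonic (hM : MulCost K R M) {f Q : R[X]} (hQ : Q.Monic) {L : ℕ}
    (hL : 0 < L) (hf : f.degree < L) :
    Derives K (coeffSet f ∪ coeffSet Q) (36 * M L) (coeffSet (f %ₘ Q)) := by
  rcases subsingleton_or_nontrivial R with _ | _
  · rw [Subsingleton.elim (f %ₘ Q) f]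
    exact .done fun x hx => Or.inl (Or.inl hx)
  set n := Q.natDegree with hn
  by_cases hfn : f.degree < Q.degree
  · rw [(modByMonic_eq_self_iff hQ).2 hfn]
    exact .done fun x hx => Or.inl (Or.inl hx)
  have hnL : n < L := by
    rw [not_lt, degree_eq_natDegree hQ.ne_zero] at hfn
    exact_mod_cast hfn.trans_lt hf
  obtain ⟨m, rfl⟩ : ∃ m, L = n + (m + 1) := ⟨L - n - 1, by omega⟩
  set r := f %ₘ Q with hr
  set q := f /ₘ Q with hq
  have hrn : r.degree < n := by
    have := degree_modByMonic_lt f hQ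
    rwa [degree_eq_natDegree hQ.ne_zero] at this
  have hqm : q.natDegree ≤ m := by
    rw [hq, natDegree_divByMonic f hQ]
    have := natDegree_lt_of_degree_lt hL hf
    omega
  have hfe : f = r + Q * q := (modByMonic_add_div f Q).symm
  have hrefl : reflect (n + m) f = reflect (n + m) r + reflect n Q * reflect m q := by
    rw [← reflect_mul Q q hn.ge hqm, ← reflect_add, ← hfe]
  have hq0 : (reflect n Q).coeff 0 = 1 := by
    rw [coeff_reflect, revAt_le (Nat.zero_le _), Nat.sub_zero, hn]
    exact hQ
  have hfd : (reflect (n + m) f).degree < (n + (m + 1) : ℕ) :=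
    degree_reflect_lt hf (by omega)
  have hrr : X ^ (m + 1) ∣ reflect (n + m) r := by
    rw [X_pow_dvd_iff]
    intro k hk
    rw [coeff_reflect, revAt_le (by omega)]
    exact (degree_lt_iff_coeff_zero r n).1 hrn _ (by omega)
  obtain ⟨t, ht, hdvd, hd⟩ := hM.derives_series_div hq0 (Nat.succ_pos m) (by omega) hfd
  obtain ⟨g, -, hg, -⟩ := hM.exists_inverse hq0 (Nat.succ_pos m)
  have hqt : t = reflect m q := by
    rw [← sub_eq_zero]
    -- R may have zero divisors, so the reversal of Q is removed by multiplying with its inverse g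
    -- modulo X^(m+1) rather than by cancellation.
    have h1 : X ^ (m + 1) ∣ t - reflect m q := by
      have h2 : t - reflect m q = g * ((reflect n Q * t - reflect (n + m) f) +
          reflect (n + m) r) - (reflect n Q * g - 1) * (t - reflect m q) := by
        rw [hrefl]; ring
      rw [h2]
      exact dvd_sub (Dvd.dvd.mul_left (dvd_add hdvd hrr) _) (Dvd.dvd.mul_right hg _)
    have h3 : (t - reflect m q).degree < (m + 1 : ℕ) := by
      refine (degree_sub_le _ _).trans_lt (max_lt ht (degree_reflect_lt ?_ m.lt_succ_self))
      exact degree_le_natDegree.trans_lt (by exact_mod_cast (by omega : q.natDegree < m + 1))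
    ext k
    rw [coeff_zero]
    by_cases hk : k < m + 1
    · exact X_pow_dvd_iff.1 h1 k hk
    · exact (degree_lt_iff_coeff_zero _ _).1 h3 k (by omega)
  have hqt' : q = reflect m t := by rw [hqt, reflect_reflect]
  have hQd : Q.degree < (n + (m + 1) : ℕ) := by
    rw [degree_eq_natDegree hQ.ne_zero]
    exact_mod_cast (by omega : Q.natDegree < n + (m + 1))
  have hqd : q.degree < (n + (m + 1) : ℕ) :=
    degree_le_natDegree.trans_lt (by exact_mod_cast (by omega : q.natDegree < n + (m + 1)))
  have hQq : Q * q = f - r := by rw [hfe]; ring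
  have hre : r = f - Q * q := by rw [hQq]; ring
  have d1 : Derives K (coeffSet f ∪ coeffSet Q) (33 * M (n + (m + 1))) (coeffSet q) := by
    refine (hd.mono_left ?_).mono_right ?_
    · refine Set.union_subset ((coeffSet_reflect_subset _ _).trans ?_)
        ((coeffSet_reflect_subset _ _).trans ?_)
      · exact fun x hx => Or.inl (Or.inl hx)
      · exact fun x hx => Or.inl (Or.inr hx)
    · rw [hqt']
      exact (coeffSet_reflect_subset _ _).trans Set.subset_union_left
  have d2 := d1.trans' (hM.derives_mul hL hQd hqd)
    (by intro x hx; simp only [Set.mem_union] at hx ⊢; tauto)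
  have d3 := d2.trans' (derives_sub hf (g := Q * q) (by
      rw [hQq]
      exact (degree_sub_le _ _).trans_lt
        (max_lt hf (degree_lt_of_degree_lt hrn (by omega)))))
    (by intro x hx; simp only [Set.mem_union] at hx ⊢; tauto)
  rw [← hre] at d3
  refine d3.mono_cost ?_
  have := hM.le_self _ hL
  omega

end MulCost

/-! ### Conversion to the base `X ^ p - X` -/

section BaseConversion

variable {K R : Type} [CommRing K] [CommRing R] [Algebra K R]

/-- Modulo the divisor X^a is X^b, so the leading coefficient moves down a - b places at the price
of one addition, and it is itself a coefficient of the quotient. The subtraction L - a is truncated: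
for L ≤ a the quotient is 0. -/
theorem exists_sparse_div {a b : ℕ} (hba : b < a) (L : ℕ) (f : R[X]) (hf : f.degree < L) :
    ∃ q r : R[X], f = q * (X ^ a - X ^ b) + r ∧ r.degree < a ∧ q.degree < (L - a : ℕ) ∧
      Derives K (coeffSet f) L (coeffSet q ∪ coeffSet r) := by
  induction L generalizing f with
  | zero =>
    have h0 : f = 0 := degree_eq_bot.1 (Nat.WithBot.lt_zero_iff.1 hf)
    subst h0
    exact ⟨0, 0, by simp, by simp, by simp, .done (by simp)⟩
  | succ L ih =>
    by_cases hLa : L + 1 ≤ a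
    · refine ⟨0, f, by simp, degree_lt_of_degree_lt hf hLa, by simp, .done ?_⟩
      refine Set.union_subset (coeffSet_subset_iff.2 fun k => ?_) Set.subset_union_left
      rw [coeff_zero]
      exact zero_mem_union_range _
    rw [degree_lt_iff_coeff_zero] at hf
    set c := f.coeff L with hc
    set f' := f - monomial L c + monomial (L - a + b) c with hf'
    have hcoeff : ∀ k, f'.coeff k =
        if k = L then 0 else if k = L - a + b then f.coeff k + c else f.coeff k := by
      intro k
      rw [hf', coeff_add, coeff_sub, coeff_monomial, coeff_monomial]
      by_cases h1 : L = k
      · subst h1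
        rw [if_pos rfl, if_neg (by omega), if_pos rfl, hc]
        ring
      · rw [if_neg h1, if_neg (Ne.symm h1 : ¬k = L)]
        by_cases h2 : L - a + b = k
        · rw [if_pos h2, if_pos h2.symm]; ring
        · rw [if_neg h2, if_neg (fun h => h2 h.symm)]; ring
    obtain ⟨q, r, hqr, hr, hq, hd⟩ := ih f' (by
      rw [degree_lt_iff_coeff_zero]
      intro k hk
      rw [hcoeff]
      split_ifs with h1 h2
      · rfl
      · omega
      · exact hf k (by omega))
    rw [degree_lt_iff_coeff_zero] at hq
    refine ⟨q + monomial (L - a) c, r, ?_, hr, ?_, ?_⟩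
    · have h1 : f = f' + monomial L c - monomial (L - a + b) c := by rw [hf']; ring
      have h2 : (monomial L c : R[X]) = monomial (L - a) c * X ^ a := by
        rw [monomial_mul_X_pow, Nat.sub_add_cancel (by omega)]
      have h3 : (monomial (L - a + b) c : R[X]) = monomial (L - a) c * X ^ b := by
        rw [monomial_mul_X_pow]
      rw [h1, hqr, h2, h3]; ring
    · rw [degree_lt_iff_coeff_zero]
      intro k hk
      rw [coeff_add, coeff_monomial, if_neg (by omega), add_zero]
      exact hq k (by omega)
    · refine .step .add (Or.inl (coeff_mem_coeffSet f (L - a + b)))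
        (Or.inl (coeff_mem_coeffSet f L)) ?_
      have h1 : coeffSet f' ⊆ insert (ArithOp.add.apply (f.coeff (L - a + b)) c) (coeffSet f) ∪
          Set.range (algebraMap K R) := by
        rw [coeffSet_subset_iff]
        intro k
        rw [hcoeff]
        split_ifs with h1 h2
        · exact zero_mem_union_range _
        · exact Or.inl (Or.inl (by rw [h2]; rfl))
        · exact Or.inl (Or.inr (coeff_mem_coeffSet f k))
      refine (hd.mono_left h1).keep.mono_right (Set.union_subset ?_ ?_)
      · rw [coeffSet_subset_iff]
        intro k
        rw [coeff_add, coeff_monomial]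
        by_cases hk : L - a = k
        · rw [if_pos hk, hq k (by omega), zero_add]
          exact Or.inl (Or.inl (Or.inr (coeff_mem_coeffSet f L)))
        · rw [if_neg hk, add_zero]
          exact Or.inl (Or.inr (Or.inl (coeff_mem_coeffSet q k)))
      · exact fun x hx => Or.inl (Or.inr (Or.inr hx))

/-- The polynomial with the digits `W 0, …, W (p - 1)`, that is
`∑ b, X ^ b * W b (X ^ p - X)`. -/
noncomputable def baseEval {p : ℕ} (W : Fin p → R[X]) : R[X] :=
  ∑ b : Fin p, X ^ (b : ℕ) * (W b).comp (X ^ p - X)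

theorem map_baseEval {S : Type} [CommRing S] (φ : R →+* S) {p : ℕ} (W : Fin p → R[X]) :
    (baseEval W).map φ = baseEval fun b => (W b).map φ := by
  simp [baseEval, Polynomial.map_sum, Polynomial.map_comp]

theorem baseEval_sub {p : ℕ} (W V : Fin p → R[X]) :
    baseEval (fun b => W b - V b) = baseEval W - baseEval V := by
  simp [baseEval, sub_comp, mul_sub, Finset.sum_sub_distrib]

theorem baseEval_add_X_pow_mul {p : ℕ} (n : ℕ) (W V : Fin p → R[X]) :
    baseEval (fun b => W b + X ^ n * V b) = baseEval W + (X ^ p - X) ^ n * baseEval V := by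
  simp only [baseEval, add_comp, mul_comp, X_pow_comp, mul_add, Finset.sum_add_distrib,
    Finset.mul_sum]
  congr 1
  exact Finset.sum_congr rfl fun b _ => by ring

theorem baseEval_C {p : ℕ} (u : ℕ → R) : baseEval (fun b : Fin p => C (u b)) = ofCoeffs p u := by
  simp only [baseEval, C_comp, ofCoeffs, ← Fin.sum_univ_eq_sum_range (fun j => monomial j (u j)) p]
  exact Finset.sum_congr rfl fun b _ => by rw [mul_comm, C_mul_X_pow_eq_monomial]

/-- Additivity of Frobenius; this sparsity is what makes the base change cheap. -/
theorem X_pow_sub_X_pow_prime_pow {p : ℕ} [Fact p.Prime] [CharP R p] (k : ℕ) :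
    ((X : R[X]) ^ p - X) ^ p ^ k = X ^ p ^ (k + 1) - X ^ p ^ k := by
  rw [sub_pow_char_pow, ← pow_mul, pow_succ' p k]

theorem monic_X_pow_sub_X [Nontrivial R] {p : ℕ} (hp : 1 < p) :
    ((X : R[X]) ^ p - X).Monic ∧ ((X : R[X]) ^ p - X).natDegree = p := by
  have h : ((X : R[X]) ^ p - X).natDegree = p := by
    rw [natDegree_sub_eq_left_of_natDegree_lt] <;> simp [hp]
  refine ⟨?_, h⟩
  rw [Monic, leadingCoeff, h, coeff_sub, coeff_X_pow_self, coeff_X, if_neg (by omega), sub_zero]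

/-- Uniqueness of the digits: the constant terms of the W b form the remainder modulo the monic
polynomial X^p - X, and the rest forms the quotient, to which induction applies. -/
theorem eq_zero_of_baseEval_eq_zero [Nontrivial R] {p : ℕ} (hp : 1 < p) (W : Fin p → R[X])
    (h : baseEval W = 0) (b : Fin p) : W b = 0 := by
  obtain ⟨n, hn⟩ : ∃ n : ℕ, ∀ b, (W b).degree < n := by
    refine ⟨(∑ b, (W b).natDegree) + 1, fun b => degree_le_natDegree.trans_lt ?_⟩
    exact_mod_cast Nat.lt_succ_of_le
      (Finset.single_le_sum (f := fun b => (W b).natDegree) (by simp) (Finset.mem_univ b))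
  induction n generalizing W b with
  | zero => exact degree_eq_bot.1 (Nat.WithBot.lt_zero_iff.1 (hn b))
  | succ n ih =>
    obtain ⟨hm, hd⟩ := monic_X_pow_sub_X (R := R) hp
    have h1 : ∀ b, W b = C ((W b).coeff 0) + X ^ 1 * divX (W b) := fun b => by
      conv_lhs => rw [← divX_mul_X_add (W b)]
      ring
    let u : ℕ → R := fun j => if hj : j < p then (W ⟨j, hj⟩).coeff 0 else 0
    have hu : ∀ b : Fin p, u b = (W b).coeff 0 := fun b => by simp [u]
    have h2 : baseEval W = ofCoeffs p u + (X ^ p - X) * baseEval fun b => divX (W b) := by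
      rw [← baseEval_C]
      conv_rhs => rw [← pow_one ((X : R[X]) ^ p - X)]
      rw [← baseEval_add_X_pow_mul]
      congr 1
      funext b
      rw [hu]
      exact h1 b
    rw [h] at h2
    obtain ⟨h3, h4⟩ := div_modByMonic_unique _ _ hm ⟨h2.symm, by
      rw [degree_eq_natDegree hm.ne_zero, hd]; exact degree_ofCoeffs_lt _ _⟩
    rw [zero_divByMonic] at h3
    rw [zero_modByMonic] at h4
    have h5 : (W b).coeff 0 = 0 := by
      have := congrArg (fun f => coeff f (b : ℕ)) h4
      simpa [coeff_ofCoeffs, hu] using this.symm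
    rw [h1 b, h5, ih (fun b => divX (W b)) h3.symm b fun b => ?_]
    · simp
    · rw [degree_lt_iff_coeff_zero]
      intro k hk
      rw [coeff_divX]
      exact (degree_lt_iff_coeff_zero _ _).1 (hn b) _ (by omega)

/-- The digits `W` have the sizes of the digits of a polynomial of degree less than `L`. -/
def DigitBound {p : ℕ} (W : Fin p → R[X]) (L : ℕ) : Prop :=
  ∀ (b : Fin p) (j : ℕ), L ≤ p * j + b → (W b).coeff j = 0

theorem DigitBound.degree_lt {p n : ℕ} {W : Fin p → R[X]} (h : DigitBound W (p * n)) (b : Fin p) :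
    (W b).degree < n := by
  rw [degree_lt_iff_coeff_zero]
  exact fun j hj => h b j ((Nat.mul_le_mul_left p hj).trans (Nat.le_add_right _ _))

theorem digitBound_of_degree_lt {p n : ℕ} {W : Fin p → R[X]} (h : ∀ b, (W b).degree < n) :
    DigitBound W (p * n) := by
  intro b j hj
  refine (degree_lt_iff_coeff_zero _ _).1 (h b) j ?_
  by_contra hc
  have : p * (j + 1) ≤ p * n := Nat.mul_le_mul_left p (by omega)
  rw [mul_add] at this
  have hb := b.2
  omega

-- Divide by (X^p - X)^(p^k), which splits off blocks of length p^(k+1). At most p blocks occur,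
-- each split costs at most L additions, and the remainders are converted recursively; hence p L
-- operations for each of the k levels.
variable (K) in
theorem exists_baseEval_eq {p : ℕ} [Fact p.Prime] [CharP R p] (k : ℕ) :
    ∀ (L : ℕ) (f : R[X]), f.degree < L → L ≤ p ^ (k + 1) →
      ∃ W : Fin p → R[X], f = baseEval W ∧ DigitBound W L ∧
        Derives K (coeffSet f) (k * p * L) (⋃ b, coeffSet (W b)) := by
  have hp : 0 < p := (Fact.out : p.Prime).pos
  induction k with
  | zero =>
    intro L f hf hL
    rw [zero_add, pow_one] at hL
    refine ⟨fun b => C (f.coeff b), ?_, ?_, .done ?_⟩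
    · rw [baseEval_C, ofCoeffs_coeff_of_degree_lt (degree_lt_of_degree_lt hf hL)]
    · intro b j hj
      rw [coeff_C]
      split_ifs with h
      · subst h
        exact (degree_lt_iff_coeff_zero _ _).1 hf _ (by omega)
      · rfl
    · refine Set.iUnion_subset fun b => coeffSet_subset_iff.2 fun j => ?_
      rw [coeff_C]
      split_ifs
      · exact Or.inl (coeff_mem_coeffSet _ _)
      · exact zero_mem_union_range _
  | succ k ih =>
    set a := p ^ (k + 1) with ha
    have hap : a = p * p ^ k := by rw [ha, pow_succ, mul_comm]
    have key : ∀ (m L : ℕ) (f : R[X]), f.degree < L → L ≤ m * a →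
        ∃ W : Fin p → R[X], f = baseEval W ∧ DigitBound W L ∧
          Derives K (coeffSet f) (m * L + k * p * L) (⋃ b, coeffSet (W b)) := by
      intro m
      induction m with
      | zero =>
        intro L f hf hL
        obtain ⟨W, h1, h2, h3⟩ := ih L f hf (by omega)
        exact ⟨W, h1, h2, h3.mono_cost (by omega)⟩
      | succ m ihm =>
        intro L f hf hL
        by_cases hLa : L ≤ a
        · obtain ⟨W, h1, h2, h3⟩ := ih L f hf hLa
          exact ⟨W, h1, h2, h3.mono_cost (by omega)⟩
        have hlt : p ^ k < a := Nat.pow_lt_pow_right (Fact.out : p.Prime).one_lt (by omega)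
        obtain ⟨q, r, hqr, hr, hq, hd⟩ := exists_sparse_div (K := K) hlt L f hf
        obtain ⟨V, hV1, hV2, hV3⟩ := ihm (L - a) q hq (by
          rw [Nat.succ_mul] at hL; omega)
        obtain ⟨W, hW1, hW2, hW3⟩ := ih a r hr le_rfl
        -- The digits of the remainder have degree below p^k, so this sum only concatenates
        -- coefficient lists and needs no arithmetic.
        refine ⟨fun b => W b + X ^ p ^ k * V b, ?_, ?_, ?_⟩
        · rw [baseEval_add_X_pow_mul, X_pow_sub_X_pow_prime_pow, ← hV1, ← hW1, hqr]
          ring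
        · intro b j hj
          rw [coeff_add, hW2 b j (by omega), coeff_X_pow_mul', zero_add]
          split_ifs with h
          · refine hV2 b _ ?_
            obtain ⟨i, rfl⟩ := Nat.exists_eq_add_of_le h
            rw [mul_add] at hj
            rw [Nat.add_sub_cancel_left]
            omega
          · rfl
        · have h1 := hd.trans' ((hW3.mono_left (S' := coeffSet q ∪ coeffSet r)
            (fun x hx => Or.inl (Or.inr hx))).union (hV3.mono_left
            (fun x hx => Or.inl (Or.inl hx)))) (fun x hx => Or.inl (Or.inr hx))
          refine (h1.mono_right (Set.iUnion_subset fun b => coeffSet_subset_iff.2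
            fun j => ?_)).mono_cost ?_
          · rw [coeff_add, coeff_X_pow_mul']
            split_ifs with h
            · rw [hW2 b j ?_, zero_add]
              · exact Or.inl (Or.inr (Set.mem_iUnion.2 ⟨b, coeff_mem_coeffSet _ _⟩))
              · rw [hap]
                exact (Nat.mul_le_mul_left p h).trans (Nat.le_add_right _ _)
            · rw [add_zero]
              exact Or.inl (Or.inl (Set.mem_iUnion.2 ⟨b, coeff_mem_coeffSet _ _⟩))
          · obtain ⟨l, rfl⟩ := Nat.exists_eq_add_of_le (not_le.1 hLa).le
            rw [Nat.add_sub_cancel_left]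
            nlinarith [Nat.zero_le (m * a)]
    intro L f hf hL
    obtain ⟨W, h1, h2, h3⟩ := key p L f hf (by rw [ha, ← pow_succ']; exact hL)
    exact ⟨W, h1, h2, h3.mono_cost (by ring_nf; rfl)⟩

theorem coeffSet_X_pow_mul_subset (n : ℕ) (f : R[X]) :
    coeffSet (X ^ n * f) ⊆ coeffSet f ∪ Set.range (algebraMap K R) := by
  rw [coeffSet_subset_iff]
  intro k
  rw [coeff_X_pow_mul']
  split_ifs
  · exact Or.inl (coeff_mem_coeffSet _ _)
  · exact zero_mem_union_range _

theorem degree_X_pow_mul_lt {f : R[X]} {m n L : ℕ} (hf : f.degree < m) (h : n + m ≤ L) :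
    (X ^ n * f).degree < (L : WithBot ℕ) := by
  rw [degree_lt_iff_coeff_zero] at hf ⊢
  intro k hk
  rw [coeff_X_pow_mul']
  split_ifs
  · exact hf _ (by omega)
  · rfl

-- The same recursion run backwards. Multiplying by X^a - X^(p^k) and adding takes one addition and
-- one subtraction of polynomials, whence the factor 2.
variable (K) in
theorem derives_baseEval {p : ℕ} [Fact p.Prime] [CharP R p] (k : ℕ) :
    ∀ (L : ℕ) (W : Fin p → R[X]), DigitBound W L → L ≤ p ^ (k + 1) →
      (baseEval W).degree < L ∧
        Derives K (⋃ b, coeffSet (W b)) (2 * (k * p * L)) (coeffSet (baseEval W)) := by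
  have hp : 0 < p := (Fact.out : p.Prime).pos
  induction k with
  | zero =>
    intro L W hW hL
    rw [zero_add, pow_one] at hL
    let u : ℕ → R := fun j => if hj : j < p then (W ⟨j, hj⟩).coeff 0 else 0
    have hu : ∀ b : Fin p, u b = (W b).coeff 0 := fun b => by simp [u]
    have h1 : baseEval W = ofCoeffs p u := by
      rw [← baseEval_C]
      congr 1
      funext b
      rw [hu]
      refine eq_C_of_degree_le_zero (degree_le_iff_coeff_zero _ _ |>.2 fun j hj => hW b j ?_)
      have hj' : 1 ≤ j := by exact_mod_cast hj
      nlinarith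
    rw [h1]
    constructor
    · rw [degree_lt_iff_coeff_zero]
      intro j hj
      rw [coeff_ofCoeffs]
      split_ifs with h
      · rw [hu ⟨j, h⟩]
        exact hW _ _ (by simpa using hj)
      · rfl
    · refine .done (coeffSet_ofCoeffs_subset fun j hj => ?_)
      rw [hu ⟨j, hj⟩]
      exact Or.inl (Set.mem_iUnion.2 ⟨_, coeff_mem_coeffSet _ _⟩)
  | succ k ih =>
    set a := p ^ (k + 1) with ha
    have hap : a = p * p ^ k := by rw [ha, pow_succ, mul_comm]
    have key : ∀ (m L : ℕ) (W : Fin p → R[X]), DigitBound W L → L ≤ m * a →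
        (baseEval W).degree < L ∧ Derives K (⋃ b, coeffSet (W b)) (2 * (m * L + k * p * L))
          (coeffSet (baseEval W)) := by
      intro m
      induction m with
      | zero =>
        intro L W hW hL
        obtain ⟨h1, h2⟩ := ih L W hW (by omega)
        exact ⟨h1, h2.mono_cost (by omega)⟩
      | succ m ihm =>
        intro L W hW hL
        by_cases hLa : L ≤ a
        · obtain ⟨h1, h2⟩ := ih L W hW hLa
          exact ⟨h1, h2.mono_cost (by omega)⟩
        have hlt : p ^ k < a := Nat.pow_lt_pow_right (Fact.out : p.Prime).one_lt (by omega)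
        choose V hV using fun b => X_pow_dvd_sub_ofCoeffs (p ^ k) (W b)
        set U : Fin p → R[X] := fun b => ofCoeffs (p ^ k) (W b).coeff with hU
        have hWUV : W = fun b => U b + X ^ p ^ k * V b := by
          funext b
          rw [← hV b]
          ring
        have hVc : ∀ b j, (V b).coeff j = (W b).coeff (p ^ k + j) := by
          intro b j
          have := congrArg (fun f => coeff f (p ^ k + j)) (hV b)
          simp only [coeff_sub, coeff_ofCoeffs, coeff_X_pow_mul'] at this
          simpa using this.symm
        obtain ⟨hU1, hU2⟩ := ih a U (by
          rw [hap]
          exact digitBound_of_degree_lt fun b => degree_ofCoeffs_lt _ _) le_rfl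
        obtain ⟨hV1, hV2⟩ := ihm (L - a) V (by
          intro b j hj
          rw [hVc]
          refine hW b _ ?_
          rw [mul_add]
          omega) (by rw [Nat.succ_mul] at hL; omega)
        have hsum : baseEval W = (baseEval U + X ^ a * baseEval V) - X ^ p ^ k * baseEval V := by
          conv_lhs => rw [hWUV]
          rw [baseEval_add_X_pow_mul, X_pow_sub_X_pow_prime_pow]
          ring
        have e1 : (baseEval U).degree < L := degree_lt_of_degree_lt hU1 (by omega)
        have e2 : (X ^ a * baseEval V).degree < (L : WithBot ℕ) := degree_X_pow_mul_lt hV1 (by omega)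
        have e3 : (X ^ p ^ k * baseEval V).degree < (L : WithBot ℕ) := degree_X_pow_mul_lt hV1 (by omega)
        have e4 := (degree_add_le (baseEval U) (X ^ a * baseEval V)).trans_lt (max_lt e1 e2)
        rw [hsum]
        refine ⟨(degree_sub_le _ _).trans_lt (max_lt e4 e3), ?_⟩
        have d1 : Derives K (⋃ b, coeffSet (W b)) (2 * (k * p * a)) (coeffSet (baseEval U)) := by
          refine hU2.mono_left (Set.iUnion_subset fun b =>
            (coeffSet_truncation_subset (K := K) _ _).trans ?_)
          exact Set.union_subset_union_left _ (Set.subset_iUnion (fun b => coeffSet (W b)) b)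
        have d2 : Derives K (⋃ b, coeffSet (W b)) (2 * (m * (L - a) + k * p * (L - a)))
            (coeffSet (baseEval V)) := by
          refine hV2.mono_left (Set.iUnion_subset fun b => coeffSet_subset_iff.2 fun j => ?_)
          rw [hVc]
          exact Or.inl (Set.mem_iUnion.2 ⟨b, coeff_mem_coeffSet _ _⟩)
        have s1 := coeffSet_X_pow_mul_subset (K := K) a (baseEval V)
        have s2 := coeffSet_X_pow_mul_subset (K := K) (p ^ k) (baseEval V)
        have d3 := (d1.union d2).trans (((derives_add e1 e2).mono_left
          (S' := coeffSet (baseEval U) ∪ coeffSet (baseEval V)) (Set.union_subset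
            (fun x hx => Or.inl (Or.inl hx)) (s1.trans (Set.union_subset_union_left _
              Set.subset_union_right)))).keep)
        have d4 := d3.trans ((derives_sub e4 e3).mono_left (Set.union_subset
          (fun x hx => Or.inl (Or.inr hx)) (s2.trans (Set.union_subset_union_left _
            (fun x hx => Or.inl (Or.inr hx))))))
        refine d4.mono_cost ?_
        obtain ⟨l, rfl⟩ := Nat.exists_eq_add_of_le (not_le.1 hLa).le
        rw [Nat.add_sub_cancel_left]
        nlinarith [Nat.zero_le (m * a)]
    intro L W hW hL
    obtain ⟨h1, h2⟩ := key p L W hW (by rw [ha, ← pow_succ']; exact hL)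
    exact ⟨h1, h2.mono_cost (by ring_nf; rfl)⟩

end BaseConversion

/-! ### Artin–Schreier extensions of finite fields -/

section ArtinSchreier

variable {p : ℕ} [Fact p.Prime]

theorem artinSchreier_monic {A : Type} [CommRing A] [Nontrivial A] {p : ℕ} (hp : 1 < p) (γ : A) :
    (X ^ p - X - C γ : A[X]).Monic ∧ (X ^ p - X - C γ : A[X]).natDegree = p := by
  obtain ⟨h1, h2⟩ := monic_X_pow_sub_X (R := A) hp
  have h3 : (X ^ p - X - C γ : A[X]).natDegree = p := by rw [natDegree_sub_C, h2]
  refine ⟨?_, h3⟩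
  rw [Monic, leadingCoeff, h3, coeff_sub, coeff_C, if_neg (by omega), sub_zero]
  rw [Monic, leadingCoeff, h2] at h1
  exact h1

theorem pow_prime_pow_of_artinSchreier {Ω : Type} [CommRing Ω] [CharP Ω p] {β γ : Ω}
    (h : β ^ p = β + γ) (k : ℕ) : β ^ p ^ k = β + ∑ j ∈ Finset.range k, γ ^ p ^ j := by
  induction k with
  | zero => simp
  | succ k ih =>
    rw [pow_succ, pow_mul, ih, add_pow_char, h, sum_pow_char, Finset.sum_range_succ']
    simp only [pow_succ, pow_mul, pow_zero, pow_one]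
    ring

section Adjoin

variable {A B : Type} [Field A] [Field B] [Algebra (ZMod p) A] [Algebra A B]
  [Algebra (ZMod p) B] [IsScalarTower (ZMod p) A B]

theorem algebraMap_mem_of_adjoin_eq_top {γ : A} (hγ : Algebra.adjoin (ZMod p) {γ} = ⊤)
    (S : Subalgebra (ZMod p) B) (hS : algebraMap A B γ ∈ S) (a : A) : algebraMap A B a ∈ S := by
  have h1 : a ∈ Algebra.adjoin (ZMod p) {γ} := hγ ▸ Algebra.mem_top
  have h2 : Algebra.adjoin (ZMod p) {γ} ≤ S.comap (IsScalarTower.toAlgHom (ZMod p) A B) := by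
    refine Algebra.adjoin_le ?_
    rintro _ rfl
    exact hS
  exact h2 h1

theorem subalgebra_eq_top_of_artinSchreier {γ : A} (hγ : Algebra.adjoin (ZMod p) {γ} = ⊤)
    (S : Subalgebra (ZMod p) B) (hS : algebraMap A B γ ∈ S) {x : B}
    (hx : Algebra.adjoin A {x} = ⊤) (hxS : x ∈ S) : S = ⊤ := by
  let S' : Subalgebra A B :=
    { S.toSubsemiring with algebraMap_mem' := algebraMap_mem_of_adjoin_eq_top hγ S hS }
  have h1 : Algebra.adjoin A {x} ≤ S' := Algebra.adjoin_le (by rintro _ rfl; exact hxS)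
  rw [hx, top_le_iff] at h1
  refine eq_top_iff.2 fun b _ => ?_
  have : b ∈ S' := h1 ▸ Algebra.mem_top
  exact this

end Adjoin

variable {A : Type} [Field A] [Algebra (ZMod p) A]

/-- For a root β and q = |A|, iterating β^p = β + γ gives β^q = β + Tr(γ). The q-power map permutes
the roots of the minimal polynomial of β, so that polynomial has the p distinct roots β + j Tr(γ)
and must be the whole of X^p - X - γ. -/
theorem irreducible_artinSchreier [Finite A] {γ : A} (hγ : Algebra.trace (ZMod p) A γ ≠ 0) :
    Irreducible (X ^ p - X - C γ : A[X]) := by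
  have hp : p.Prime := Fact.out
  have : CharP A p := charP_of_injective_algebraMap (algebraMap (ZMod p) A).injective p
  let Ω := AlgebraicClosure A
  have : CharP Ω p := charP_of_injective_algebraMap (algebraMap A Ω).injective p
  obtain ⟨hm, hd⟩ := artinSchreier_monic hp.one_lt γ
  set f : A[X] := X ^ p - X - C γ with hf
  obtain ⟨β, hβ⟩ := IsAlgClosed.exists_aeval_eq_zero Ω f (by
    rw [degree_eq_natDegree hm.ne_zero, hd]
    exact_mod_cast hp.ne_zero)
  have hβp : β ^ p = β + algebraMap A Ω γ := by
    simp only [hf, map_sub, map_pow, aeval_X, aeval_C] at hβ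
    linear_combination hβ
  have := Fintype.ofFinite A
  set r := Module.finrank (ZMod p) A with hr
  have hcard : Fintype.card A = p ^ r := by
    rw [Module.card_eq_pow_finrank (K := ZMod p) (V := A), ZMod.card]
  set τ := Algebra.trace (ZMod p) A γ with hτ
  set t : Ω := algebraMap A Ω (algebraMap (ZMod p) A τ) with ht
  have hβq : β ^ p ^ r = β + t := by
    rw [pow_prime_pow_of_artinSchreier hβp, ht, hτ, FiniteField.algebraMap_trace_eq_sum_pow,
      map_sum, Nat.card_zmod]
    simp only [map_pow]
    rfl
  have htq : ∀ j : ℕ, ((j : Ω) * t) ^ p ^ r = j * t := by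
    intro j
    have h1 : ((j : Ω) * t) = algebraMap A Ω (algebraMap (ZMod p) A (j * τ)) := by simp [ht]
    rw [h1, ← map_pow, ← map_pow, ZMod.pow_card_pow]
  set m := minpoly A β with hmin
  have hint : IsIntegral A β := ⟨f, hm, hβ⟩
  have hroot : ∀ y : Ω, aeval y m = 0 → aeval (y ^ p ^ r) m = 0 := by
    intro y hy
    rw [← hcard, ← expand_aeval, FiniteField.expand_card, map_pow, hy, zero_pow]
    exact Fintype.card_ne_zero
  have hroots : ∀ j : ℕ, aeval (β + j * t) m = 0 := by
    intro j
    induction j with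
    | zero => rw [Nat.cast_zero, zero_mul, add_zero]; exact minpoly.aeval A β
    | succ j ih =>
      have := hroot _ ih
      rw [add_pow_char_pow, hβq, htq] at this
      rw [← this]
      congr 2
      push_cast
      ring
  have ht0 : t ≠ 0 := by
    rw [ht]
    simpa using hγ
  have hinj : Function.Injective fun j : Fin p => β + ((j : ℕ) : Ω) * t := by
    intro i j hij
    have h1 : ((i : ℕ) : Ω) = ((j : ℕ) : Ω) := mul_right_cancel₀ ht0 (add_left_cancel hij)
    have h2 := (CharP.natCast_eq_natCast Ω p).1 h1
    exact Fin.ext (Nat.ModEq.eq_of_lt_of_lt h2 i.2 j.2)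
  have hle : p ≤ m.natDegree := by
    classical
    have hm0 : m.map (algebraMap A Ω) ≠ 0 :=
      (Polynomial.map_ne_zero_iff (algebraMap A Ω).injective).2 (minpoly.ne_zero hint)
    calc p = (Finset.univ.image fun j : Fin p => β + ((j : ℕ) : Ω) * t).card := by
          rw [Finset.card_image_of_injective _ hinj, Finset.card_univ, Fintype.card_fin]
      _ ≤ (m.map (algebraMap A Ω)).roots.toFinset.card := by
          refine Finset.card_le_card fun y hy => ?_
          obtain ⟨j, -, rfl⟩ := Finset.mem_image.1 hy
          rw [Multiset.mem_toFinset, mem_roots hm0, IsRoot, eval_map_algebraMap]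
          exact hroots j
      _ ≤ (m.map (algebraMap A Ω)).roots.card := Multiset.toFinset_card_le _
      _ ≤ (m.map (algebraMap A Ω)).natDegree := card_roots' _
      _ = m.natDegree := natDegree_map _
  have : m = f := (eq_of_monic_of_dvd_of_natDegree_le (minpoly.monic hint) hm
    (minpoly.dvd A β hβ) (by rw [hd]; exact hle)).symm
  rw [← this]
  exact minpoly.irreducible hint

variable {B : Type} [Field B] [Finite B] [Algebra A B]

/-- The derivative of X^p - X - γ is -1, so by Euler's formula the last element of the basis dual to
1, x, …, x^(p-1) is -1. Duality then reads off the traces. -/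
theorem trace_pow_of_artinSchreier [Finite A] {γ : A} (pb : PowerBasis A B)
    (hpb : minpoly A pb.gen = X ^ p - X - C γ) {j : ℕ} (hj : j < p) :
    Algebra.trace A B (pb.gen ^ j) = if j = p - 1 then -1 else 0 := by
  have hp : p.Prime := Fact.out
  have : CharP A p := charP_of_injective_algebraMap (algebraMap (ZMod p) A).injective p
  obtain ⟨hm, hd⟩ := artinSchreier_monic hp.one_lt γ
  have hdim : pb.dim = p := by rw [← pb.natDegree_minpoly, hpb, hd]
  have : FiniteDimensional A B := pb.finite
  have hint : IsIntegral A pb.gen := Algebra.IsIntegral.isIntegral _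
  have hder : aeval pb.gen (derivative (minpoly A pb.gen)) = -1 := by
    rw [hpb, derivative_sub, derivative_sub, derivative_C, derivative_X, derivative_X_pow,
      CharP.cast_eq_zero A p]
    simp
  have hlast : pb.basis.traceDual ⟨p - 1, by omega⟩ = -1 := by
    rw [Module.Basis.traceDual_powerBasis_eq, hder]
    have h1 := minpolyDiv_monic hint
    have h2 := natDegree_minpolyDiv (R := A) (x := pb.gen)
    rw [hpb, hd] at h2
    rw [Monic, leadingCoeff, h2] at h1
    simp [h1]
  have h3 := pb.basis.trace_traceDual_mul ⟨p - 1, by omega⟩ ⟨j, by omega⟩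
  rw [hlast, pb.basis_eq_pow, neg_one_mul, map_neg, neg_eq_iff_eq_neg] at h3
  rw [h3]
  simp only [Fin.mk.injEq]
  split_ifs <;> simp

/-- Using x^p = x + γ twice, x^(2p-1) = x + γ + γ x^(p-1). The last term contributes -γ, and x
contributes only if 1 = p - 1, that is p = 2. -/
theorem trace_pow_two_mul_sub_one_of_artinSchreier [Finite A] {γ : A} (pb : PowerBasis A B)
    (hpb : minpoly A pb.gen = X ^ p - X - C γ) :
    Algebra.trace A B (pb.gen ^ (2 * p - 1)) = -γ - if p = 2 then 1 else 0 := by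
  have hp : p.Prime := Fact.out
  have hp2 := hp.two_le
  have : CharP A p := charP_of_injective_algebraMap (algebraMap (ZMod p) A).injective p
  have : FiniteDimensional A B := pb.finite
  have hx : pb.gen ^ p = pb.gen + algebraMap A B γ := by
    have := minpoly.aeval A pb.gen
    simp only [hpb, map_sub, map_pow, aeval_X, aeval_C] at this
    linear_combination this
  have h1 : pb.gen ^ (2 * p - 1) = pb.gen ^ 1 + γ • pb.gen ^ 0 + γ • pb.gen ^ (p - 1) := by
    have h2 : 2 * p - 1 = p + (p - 1) := by omega
    have h3 : pb.gen * pb.gen ^ (p - 1) = pb.gen ^ p := by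
      rw [← pow_succ']; congr 1; omega
    rw [h2, pow_add, hx, add_mul, h3, hx, Algebra.smul_def, Algebra.smul_def]
    ring
  rw [h1, map_add, map_add, map_smul, map_smul, trace_pow_of_artinSchreier pb hpb hp.one_lt,
    trace_pow_of_artinSchreier pb hpb hp.pos, trace_pow_of_artinSchreier pb hpb (by omega)]
  rw [if_pos rfl, if_neg (show (0 : ℕ) ≠ p - 1 by omega)]
  by_cases h : p = 2
  · rw [if_pos (by omega), if_pos h]; simp; ring
  · rw [if_neg (by omega), if_neg h]; simp

variable [Algebra (ZMod p) B] [IsScalarTower (ZMod p) A B]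

/-- The field E = 𝔽_p(z) is normal over 𝔽_p, so it contains the conjugates of z over A, hence their
sum, hence γ and all of A. As [B : A] is prime, E is A or B; it is not A, since elements of A have
relative trace p · a = 0. -/
theorem adjoin_eq_top_of_trace {γ : A} (hγ : Algebra.adjoin (ZMod p) {γ} = ⊤)
    (hdim : Module.finrank A B = p) {z : B} {s : ZMod p}
    (hz : Algebra.trace A B z = -γ - algebraMap (ZMod p) A s) (hz0 : Algebra.trace A B z ≠ 0) :
    Algebra.adjoin (ZMod p) {z} = ⊤ := by
  have hp : p.Prime := Fact.out
  have : CharP A p := charP_of_injective_algebraMap (algebraMap (ZMod p) A).injective p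
  have : FiniteDimensional A B := Module.finite_of_finrank_pos (by rw [hdim]; exact hp.pos)
  let E : IntermediateField (ZMod p) B := IntermediateField.adjoin (ZMod p) {z}
  have hzE : z ∈ E := IntermediateField.mem_adjoin_simple_self _ z
  have hE : E.toSubalgebra = Algebra.adjoin (ZMod p) {z} :=
    IntermediateField.adjoin_simple_toSubalgebra_of_isAlgebraic (Algebra.IsAlgebraic.isAlgebraic z)
  have h1 : algebraMap A B (Algebra.trace A B z) ∈ E := by
    rw [trace_eq_sum_automorphisms]
    refine sum_mem fun σ _ => ?_
    have hn : Normal (ZMod p) E := inferInstance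
    exact IntermediateField.normal_iff_forall_map_le.1 hn
      ((σ : B →ₐ[A] B).restrictScalars (ZMod p)) ⟨z, hzE, rfl⟩
  have h2 : algebraMap A B γ ∈ E := by
    have h3 : algebraMap A B γ = -algebraMap A B (Algebra.trace A B z) -
        algebraMap (ZMod p) B s := by
      rw [hz, IsScalarTower.algebraMap_apply (ZMod p) A B, map_sub, map_neg]; ring
    rw [h3]
    exact sub_mem (neg_mem h1) (E.algebraMap_mem s)
  rw [← hE]
  let S' : Subalgebra A B := { E.toSubalgebra.toSubsemiring with
    algebraMap_mem' := algebraMap_mem_of_adjoin_eq_top hγ E.toSubalgebra h2 }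
  have hs := Subalgebra.isSimpleOrder_of_finrank_prime A B (by rw [hdim]; exact hp)
  rcases hs.eq_bot_or_eq_top S' with h | h
  · exfalso
    have h4 : z ∈ S' := hzE
    rw [h] at h4
    obtain ⟨a, rfl⟩ := Algebra.mem_bot.1 h4
    rw [Algebra.trace_algebraMap, hdim] at hz0
    simp at hz0
  · refine eq_top_iff.2 fun b _ => ?_
    have : b ∈ S' := h ▸ Algebra.mem_top
    exact this

/-- In an Artin–Schreier extension `B = A[x]`, `x ^ p - x = γ`, the power `x ^ e` inherits from `γ`
that it generates the field over `𝔽_p` and that its trace is not zero. -/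
theorem trace_ne_zero_and_adjoin_eq_top [Finite A] {γ : A} (hγ : Algebra.adjoin (ZMod p) {γ} = ⊤)
    (htr : Algebra.trace (ZMod p) A γ ≠ 0) (pb : PowerBasis A B)
    (hpb : minpoly A pb.gen = X ^ p - X - C γ) {e : ℕ}
    (he : e = if p = 2 ∧ Odd (Module.finrank (ZMod p) A) then 1 else 2 * p - 1) :
    Algebra.trace (ZMod p) B (pb.gen ^ e) ≠ 0 ∧ Algebra.adjoin (ZMod p) {pb.gen ^ e} = ⊤ := by
  have hp : p.Prime := Fact.out
  have : FiniteDimensional A B := pb.finite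
  have hdim : Module.finrank A B = p := by
    rw [pb.finrank, ← pb.natDegree_minpoly, hpb, (artinSchreier_monic hp.one_lt γ).2]
  -- With e = 1, the relative trace of x is -1, whose trace to 𝔽_2 is the odd degree of A. With e =
  -- 2p - 1, the absolute trace is -Tr(γ), because the correction for p = 2 has trace [A : 𝔽_2],
  -- which is even here.
  split_ifs at he with h
  · subst he
    rw [pow_one]
    constructor
    · obtain ⟨rfl, hodd⟩ := h
      have h1 := trace_pow_of_artinSchreier pb hpb (j := 1) (by omega)
      rw [if_pos rfl, pow_one] at h1
      rw [← Algebra.trace_trace (S := A), h1, map_neg, ← map_one (algebraMap (ZMod 2) A),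
        Algebra.trace_algebraMap, nsmul_eq_mul, mul_one, neg_ne_zero,
        (ZMod.natCast_eq_one_iff_odd).2 hodd]
      exact one_ne_zero
    · refine subalgebra_eq_top_of_artinSchreier hγ _ ?_ pb.adjoin_gen_eq_top
        (Algebra.self_mem_adjoin_singleton _ _)
      have hx : algebraMap A B γ = pb.gen ^ p - pb.gen := by
        have := minpoly.aeval A pb.gen
        simp only [hpb, map_sub, map_pow, aeval_X, aeval_C] at this
        linear_combination -this
      rw [hx]
      exact sub_mem (pow_mem (Algebra.self_mem_adjoin_singleton _ _) _)
        (Algebra.self_mem_adjoin_singleton _ _)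
  · subst he
    have h1 := trace_pow_two_mul_sub_one_of_artinSchreier pb hpb
    have h2 : Algebra.trace (ZMod p) B (pb.gen ^ (2 * p - 1)) ≠ 0 := by
      rw [← Algebra.trace_trace (S := A), h1, map_sub, map_neg]
      have h3 : Algebra.trace (ZMod p) A (if p = 2 then 1 else 0) = 0 := by
        split_ifs with h2
        · subst h2
          have heven : Even (Module.finrank (ZMod 2) A) := by
            rw [← Nat.not_odd_iff_even]
            exact fun h' => h ⟨rfl, h'⟩
          rw [← map_one (algebraMap (ZMod 2) A), Algebra.trace_algebraMap, nsmul_eq_mul, mul_one]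
          exact (ZMod.natCast_eq_zero_iff_even).2 heven
        · exact map_zero _
      rw [h3, sub_zero, neg_ne_zero]
      exact htr
    refine ⟨h2, adjoin_eq_top_of_trace hγ hdim (s := if p = 2 then 1 else 0) ?_ ?_⟩
    · rw [h1]
      split_ifs <;> simp
    · intro h3
      rw [← Algebra.trace_trace (S := A), h3, map_zero] at h2
      exact h2 rfl

end ArtinSchreier

/-! ### The levels of the tower are fields -/

section Levels

variable {p : ℕ} {Q₀ : (ZMod p)[X]}

theorem aeval_gen_zero (i : ℕ) : aeval (gen p Q₀ i 0) Q₀ = 0 := by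
  have h1 : aeval (gen p Q₀ i 0) Q₀ = Ideal.Quotient.mkₐ (ZMod p) (towerIdeal p Q₀ i)
      (aeval (MvPolynomial.X (0 : Fin (i + 1))) Q₀) := by
    rw [← aeval_algHom_apply]; rfl
  rw [h1]
  exact Ideal.Quotient.eq_zero_iff_mem.2 (Ideal.subset_span (Set.mem_insert _ _))

theorem gen_succ_pow (i : ℕ) (j : Fin i) :
    gen p Q₀ i j.succ ^ p - gen p Q₀ i j.succ =
      gen p Q₀ i j.castSucc ^ gammaExp p Q₀.natDegree (j : ℕ) := by
  rw [← sub_eq_zero]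
  exact Ideal.Quotient.eq_zero_iff_mem.2 (Ideal.subset_span (Set.mem_insert_of_mem _ ⟨j, rfl⟩))

/-- The homomorphism from `U_i` given by images of the generators that satisfy the relations. -/
noncomputable def levelLift {R : Type} [CommRing R] [Algebra (ZMod p) R] (i : ℕ)
    (u : Fin (i + 1) → R) (h0 : aeval (u 0) Q₀ = 0)
    (h : ∀ j : Fin i, u j.succ ^ p - u j.succ =
      u j.castSucc ^ gammaExp p Q₀.natDegree (j : ℕ)) : Level p Q₀ i →ₐ[ZMod p] R :=
  Ideal.Quotient.liftₐ (towerIdeal p Q₀ i) (MvPolynomial.aeval u) fun a ha => by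
    have : towerIdeal p Q₀ i ≤ RingHom.ker (MvPolynomial.aeval (R := ZMod p) u) := by
      refine Ideal.span_le.2 (Set.insert_subset ?_ ?_)
      · rw [SetLike.mem_coe, RingHom.mem_ker, ← aeval_algHom_apply, MvPolynomial.aeval_X, h0]
      · rintro _ ⟨j, rfl⟩
        rw [SetLike.mem_coe, RingHom.mem_ker]
        simp [← h j]
    exact this ha

theorem levelLift_gen {R : Type} [CommRing R] [Algebra (ZMod p) R] (i : ℕ)
    (u : Fin (i + 1) → R) (h0 : aeval (u 0) Q₀ = 0)
    (h : ∀ j : Fin i, u j.succ ^ p - u j.succ =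
      u j.castSucc ^ gammaExp p Q₀.natDegree (j : ℕ)) (j : Fin (i + 1)) :
    levelLift i u h0 h (gen p Q₀ i j) = u j := by
  change MvPolynomial.aeval u (MvPolynomial.X j) = u j
  exact MvPolynomial.aeval_X u j

theorem level_ringHom_ext {R : Type} [CommRing R] {i : ℕ} {f g : Level p Q₀ i →+* R}
    (h : ∀ j, f (gen p Q₀ i j) = g (gen p Q₀ i j)) : f = g := by
  refine Ideal.Quotient.ringHom_ext (MvPolynomial.ringHom_ext' ?_ h)
  exact RingHom.ext_zmod _ _

variable (p Q₀) in
/-- The homomorphism from a level of the tower to the next one. -/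
noncomputable def levelMap (i : ℕ) : Level p Q₀ i →ₐ[ZMod p] Level p Q₀ (i + 1) :=
  levelLift i (fun j => gen p Q₀ (i + 1) j.castSucc) (aeval_gen_zero (i + 1))
    fun j => gen_succ_pow (i + 1) j.castSucc

theorem levelMap_gen (i : ℕ) (j : Fin (i + 1)) :
    levelMap p Q₀ i (gen p Q₀ i j) = gen p Q₀ (i + 1) j.castSucc :=
  levelLift_gen ..

variable (p Q₀) in
theorem topGen_succ_pow (i : ℕ) : topGen p Q₀ (i + 1) ^ p - topGen p Q₀ (i + 1) =
    levelMap p Q₀ i (topGen p Q₀ i) ^ gammaExp p Q₀.natDegree i := by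
  rw [topGen, topGen, levelMap_gen]
  exact gen_succ_pow (i + 1) (Fin.last i)

variable [Fact p.Prime]

/-- `φ` is an isomorphism of `U_i` with a finite field of degree `p ^ i * d` over `𝔽_p`, in which
the image of `γ_i` generates and has a nonzero trace. -/
structure IsLevelField (i : ℕ) {A : Type} [Field A] [Algebra (ZMod p) A]
    (φ : Level p Q₀ i ≃ₐ[ZMod p] A) : Prop where
  finite : Finite A
  finrank : Module.finrank (ZMod p) A = p ^ i * Q₀.natDegree
  trace : Algebra.trace (ZMod p) A (φ (topGen p Q₀ i) ^ gammaExp p Q₀.natDegree i) ≠ 0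
  adjoin : Algebra.adjoin (ZMod p) {φ (topGen p Q₀ i) ^ gammaExp p Q₀.natDegree i} = ⊤

theorem exists_isLevelField_zero (hQ : Irreducible Q₀)
    (htr : Algebra.trace (ZMod p) (AdjoinRoot Q₀) (AdjoinRoot.root Q₀) ≠ 0) :
    ∃ (A : Type) (_ : Field A) (_ : Algebra (ZMod p) A) (φ : Level p Q₀ 0 ≃ₐ[ZMod p] A),
      IsLevelField 0 φ := by
  have : Fact (Irreducible Q₀) := ⟨hQ⟩
  let f : Level p Q₀ 0 →ₐ[ZMod p] AdjoinRoot Q₀ :=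
    levelLift 0 (fun _ => AdjoinRoot.root Q₀) (by simp) (fun j => j.elim0)
  let g : AdjoinRoot Q₀ →+* Level p Q₀ 0 :=
    AdjoinRoot.lift (algebraMap (ZMod p) _) (gen p Q₀ 0 0) (by
      have := aeval_gen_zero (Q₀ := Q₀) (p := p) 0
      rwa [aeval_def] at this)
  have hf : ∀ j, f (gen p Q₀ 0 j) = AdjoinRoot.root Q₀ := fun j => levelLift_gen ..
  have hgf : g.comp f.toRingHom = RingHom.id _ := by
    refine level_ringHom_ext fun j => ?_
    obtain rfl : j = 0 := Subsingleton.elim (α := Fin 1) j 0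
    change g (f _) = _
    rw [hf]
    simp [g]
  have hfg : f.toRingHom.comp g = RingHom.id _ := by
    refine AdjoinRoot.ringHom_ext (RingHom.ext_zmod _ _) ?_
    change f (g _) = _
    simp only [g, AdjoinRoot.lift_root, hf]
    rfl
  let φ : Level p Q₀ 0 ≃ₐ[ZMod p] AdjoinRoot Q₀ := AlgEquiv.ofBijective f
    ⟨(show Function.LeftInverse g f from fun x => congrArg (fun h => h x) hgf).injective,
      (show Function.RightInverse g f from fun x => congrArg (fun h => h x) hfg).surjective⟩
  have hφ : φ (topGen p Q₀ 0) ^ gammaExp p Q₀.natDegree 0 = AdjoinRoot.root Q₀ := by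
    rw [gammaExp, if_pos (Or.inl rfl), pow_one]
    exact hf _
  have : Module.Finite (ZMod p) (AdjoinRoot Q₀) := (AdjoinRoot.powerBasis hQ.ne_zero).finite
  refine ⟨AdjoinRoot Q₀, inferInstance, inferInstance, φ, Module.finite_of_finite (ZMod p), ?_,
    ?_, ?_⟩
  · rw [(AdjoinRoot.powerBasis hQ.ne_zero).finrank, AdjoinRoot.powerBasis_dim, pow_zero, one_mul]
  · rwa [hφ]
  · rw [hφ]
    exact AdjoinRoot.adjoinRoot_eq_top

/-- The presentation of U_{i+1} is that of A[X]/(X^p - X - γ_i); mutually inverse maps are built on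
generators. Since γ_i has nonzero trace this quotient is a field, and both the trace and the
generation property pass to the next level. -/
theorem IsLevelField.exists_succ {i : ℕ} {A : Type} [Field A] [Algebra (ZMod p) A]
    {φ : Level p Q₀ i ≃ₐ[ZMod p] A} (h : IsLevelField i φ) :
    ∃ (B : Type) (_ : Field B) (_ : Algebra (ZMod p) B) (_ : Algebra A B)
      (_ : IsScalarTower (ZMod p) A B) (ψ : Level p Q₀ (i + 1) ≃ₐ[ZMod p] B)
      (pb : PowerBasis A B), IsLevelField (i + 1) ψ ∧
      pb.gen = ψ (topGen p Q₀ (i + 1)) ∧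
      (∀ a, ψ (levelMap p Q₀ i a) = algebraMap A B (φ a)) ∧
      minpoly A pb.gen =
        X ^ p - X - C (φ (topGen p Q₀ i) ^ gammaExp p Q₀.natDegree i) := by
  have hp : p.Prime := Fact.out
  have := h.finite
  set γ := φ (topGen p Q₀ i) ^ gammaExp p Q₀.natDegree i with hγ
  have hirr : Irreducible (X ^ p - X - C γ : A[X]) := irreducible_artinSchreier h.trace
  have : Fact (Irreducible (X ^ p - X - C γ : A[X])) := ⟨hirr⟩
  obtain ⟨hm, hdeg⟩ := artinSchreier_monic hp.one_lt γ
  set q : A[X] := X ^ p - X - C γ with hq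
  have hroot : AdjoinRoot.root q ^ p - AdjoinRoot.root q = AdjoinRoot.of q γ := by
    have h1 := AdjoinRoot.eval₂_root q
    simp only [hq, eval₂_sub, eval₂_pow, eval₂_X, eval₂_C] at h1
    linear_combination h1
  let u : Fin (i + 1 + 1) → AdjoinRoot q :=
    Fin.snoc (α := fun _ => AdjoinRoot q) (fun j => AdjoinRoot.of q (φ (gen p Q₀ i j)))
      (AdjoinRoot.root q)
  have hu : ∀ j : Fin (i + 1), u j.castSucc = AdjoinRoot.of q (φ (gen p Q₀ i j)) := fun j => by
    simp only [u, Fin.snoc_castSucc]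
  have hul : u (Fin.last (i + 1)) = AdjoinRoot.root q := by
    simp only [u, Fin.snoc_last]
  let f : Level p Q₀ (i + 1) →ₐ[ZMod p] AdjoinRoot q :=
    levelLift (i + 1) u (by
      have h1 : u 0 = ((AdjoinRoot.ofAlgHom (ZMod p) q).comp φ.toAlgHom) (gen p Q₀ i 0) := hu 0
      rw [h1, aeval_algHom_apply, aeval_gen_zero, map_zero]) (by
      intro j
      induction j using Fin.lastCases with
      | last =>
        rw [Fin.succ_last, hul, hroot, hu, ← map_pow]
        rfl
      | cast j =>
        rw [Fin.succ_castSucc, hu, hu, ← map_pow, ← map_pow, ← map_pow, ← map_pow, ← map_sub,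
          ← map_sub, gen_succ_pow]
        rfl)
  have hf : ∀ j, f (gen p Q₀ (i + 1) j) = u j := fun j => levelLift_gen ..
  let g : AdjoinRoot q →+* Level p Q₀ (i + 1) :=
    AdjoinRoot.lift ((levelMap p Q₀ i).comp φ.symm.toAlgHom).toRingHom (topGen p Q₀ (i + 1)) (by
      simp only [hq, eval₂_sub, eval₂_pow, eval₂_X, eval₂_C, topGen_succ_pow]
      rw [sub_eq_zero, ← map_pow]
      change _ = levelMap p Q₀ i (φ.symm γ)
      rw [hγ, ← map_pow, AlgEquiv.symm_apply_apply])
  have hgof : ∀ a, g (AdjoinRoot.of q a) = levelMap p Q₀ i (φ.symm a) := fun a => by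
    simp only [g, AdjoinRoot.lift_of]; rfl
  have hgroot : g (AdjoinRoot.root q) = topGen p Q₀ (i + 1) := by
    simp only [g, AdjoinRoot.lift_root]
  have hflevel : ∀ a, f (levelMap p Q₀ i a) = AdjoinRoot.of q (φ a) := by
    intro a
    have : f.toRingHom.comp (levelMap p Q₀ i).toRingHom =
        (AdjoinRoot.of q).comp (φ : Level p Q₀ i →+* A) := by
      refine level_ringHom_ext fun j => ?_
      change f (levelMap p Q₀ i _) = AdjoinRoot.of q (φ _)
      rw [levelMap_gen, hf, hu]
    exact congrArg (fun h => h a) this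
  have hgf : g.comp f.toRingHom = RingHom.id _ := by
    refine level_ringHom_ext fun j => ?_
    change g (f _) = gen p Q₀ (i + 1) j
    rw [hf]
    induction j using Fin.lastCases with
    | last => rw [hul, hgroot, topGen]
    | cast j => rw [hu, hgof, AlgEquiv.symm_apply_apply, levelMap_gen]
  have hfg : f.toRingHom.comp g = RingHom.id _ := by
    refine AdjoinRoot.ringHom_ext (RingHom.ext fun a => ?_) ?_
    · change f (g (AdjoinRoot.of q a)) = AdjoinRoot.of q a
      rw [hgof, hflevel, AlgEquiv.apply_symm_apply]
    · change f (g (AdjoinRoot.root q)) = AdjoinRoot.root q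
      rw [hgroot, topGen, hf, hul]
  let ψ : Level p Q₀ (i + 1) ≃ₐ[ZMod p] AdjoinRoot q := AlgEquiv.ofBijective f
    ⟨(show Function.LeftInverse g f from fun x => congrArg (fun h => h x) hgf).injective,
      (show Function.RightInverse g f from fun x => congrArg (fun h => h x) hfg).surjective⟩
  have hψ : ψ (topGen p Q₀ (i + 1)) = AdjoinRoot.root q := (hf _).trans hul
  let pb := AdjoinRoot.powerBasis hirr.ne_zero
  have hgen : pb.gen = AdjoinRoot.root q := AdjoinRoot.powerBasis_gen _
  have hmin : minpoly A pb.gen = q := by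
    rw [hgen, AdjoinRoot.minpoly_root hirr.ne_zero, hm.leadingCoeff, inv_one, C_1, mul_one]
  have hfin : Module.Finite A (AdjoinRoot q) := pb.finite
  have hfin' : Finite (AdjoinRoot q) := Module.finite_of_finite A
  have hfr : Module.finrank A (AdjoinRoot q) = p := by
    rw [pb.finrank, ← pb.natDegree_minpoly, hmin, hdeg]
  -- For p = 2 the degree 2^i d of A is odd exactly when i = 0 and d is odd, which is the
  -- exceptional case of the tower.
  have hexp : gammaExp p Q₀.natDegree (i + 1) =
      if p = 2 ∧ Odd (Module.finrank (ZMod p) A) then 1 else 2 * p - 1 := by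
    rw [gammaExp, h.finrank]
    refine if_congr ?_ rfl rfl
    constructor
    · rintro (h1 | ⟨h1, h2, h3⟩)
      · omega
      · obtain rfl : i = 0 := by omega
        exact ⟨h2, by simpa using h3⟩
    · rintro ⟨rfl, h2⟩
      rw [Nat.odd_mul] at h2
      refine Or.inr ⟨?_, rfl, h2.2⟩
      by_contra h3
      have h4 : Even (2 ^ i) := (Nat.even_pow' (by omega)).2 even_two
      exact Nat.not_odd_iff_even.2 h4 h2.1
  obtain ⟨h1, h2⟩ := trace_ne_zero_and_adjoin_eq_top h.adjoin h.trace pb hmin hexp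
  refine ⟨AdjoinRoot q, inferInstance, inferInstance, inferInstance, inferInstance, ψ, pb,
    ⟨hfin', ?_, ?_, ?_⟩, hgen.trans hψ.symm, hflevel, hmin⟩
  · rw [← Module.finrank_mul_finrank (ZMod p) A, hfr, h.finrank]
    ring
  · rwa [hψ, ← hgen]
  · rwa [hψ, ← hgen]

theorem exists_isLevelField (hQ : Irreducible Q₀)
    (htr : Algebra.trace (ZMod p) (AdjoinRoot Q₀) (AdjoinRoot.root Q₀) ≠ 0) (i : ℕ) :
    ∃ (A : Type) (_ : Field A) (_ : Algebra (ZMod p) A) (φ : Level p Q₀ i ≃ₐ[ZMod p] A),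
      IsLevelField i φ := by
  induction i with
  | zero => exact exists_isLevelField_zero hQ htr
  | succ i ih =>
    obtain ⟨A, _, _, φ, h⟩ := ih
    obtain ⟨B, _, _, _, _, ψ, pb, h', -⟩ := h.exists_succ
    exact ⟨B, _, _, ψ, h'⟩

end Levels

/-! ### Power projection and change of the generator -/

section PowerProjection

variable {p : ℕ} [Fact p.Prime] {A : Type} [Field A] [Algebra (ZMod p) A]

/-- Horner's recursion for the quotient of the minimal polynomial by X - z, unrolled N times. -/
theorem coeff_minpolyDiv_eq_sum (z : A) (k N : ℕ) :
    (minpolyDiv (ZMod p) z).coeff k =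
      ∑ m ∈ Finset.range N, algebraMap (ZMod p) A ((minpoly (ZMod p) z).coeff (k + m + 1)) * z ^ m +
        (minpolyDiv (ZMod p) z).coeff (k + N) * z ^ N := by
  induction N with
  | zero => simp
  | succ N ih =>
    rw [ih, Finset.sum_range_succ, coeff_minpolyDiv (ZMod p) z (k + N)]
    rw [add_assoc k N 1]
    ring

variable [Finite A]

theorem natDegree_minpoly_eq_finrank {z : A} (hz : Algebra.adjoin (ZMod p) {z} = ⊤) :
    (minpoly (ZMod p) z).natDegree = Module.finrank (ZMod p) A := by
  have hint : IsIntegral (ZMod p) z := Algebra.IsIntegral.isIntegral z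
  have h1 : (PowerBasis.ofAdjoinEqTop hint hz).gen = z := PowerBasis.ofAdjoinEqTop_gen hint hz
  rw [(PowerBasis.ofAdjoinEqTop hint hz).finrank, ← PowerBasis.natDegree_minpoly, h1]

/-- Euler: if P/(X - z) = ∑ c_k X^k, the basis dual to the powers of z is c_k / P'(z). Expand w in
this dual basis, where its coordinates are traces. -/
theorem mul_aeval_derivative_minpoly {z : A} (hz : Algebra.adjoin (ZMod p) {z} = ⊤) {n : ℕ}
    (hn : Module.finrank (ZMod p) A = n) (w : A) :
    w * aeval z (derivative (minpoly (ZMod p) z)) =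
      aeval z (ofCoeffs n fun m => ∑ k ∈ Finset.range n,
        Algebra.trace (ZMod p) A (w * z ^ k) * (minpoly (ZMod p) z).coeff (k + m + 1)) := by
  have hint : IsIntegral (ZMod p) z := Algebra.IsIntegral.isIntegral z
  let pb := PowerBasis.ofAdjoinEqTop hint hz
  have hgen : pb.gen = z := PowerBasis.ofAdjoinEqTop_gen hint hz
  have hdim : pb.dim = n := by rw [← pb.finrank, hn]
  have hdeg := natDegree_minpoly_eq_finrank hz
  have hder : aeval z (derivative (minpoly (ZMod p) z)) ≠ 0 :=
    (Algebra.IsSeparable.isSeparable (ZMod p) z).aeval_derivative_ne_zero (minpoly.aeval _ _)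
  have hc : ∀ k, (minpolyDiv (ZMod p) z).coeff k = ∑ m ∈ Finset.range n,
      algebraMap (ZMod p) A ((minpoly (ZMod p) z).coeff (k + m + 1)) * z ^ m := by
    intro k
    rw [coeff_minpolyDiv_eq_sum z k n, coeff_eq_zero_of_natDegree_lt (n := k + n), zero_mul,
      add_zero]
    have := natDegree_minpolyDiv_lt hint
    omega
  have hw : w * aeval z (derivative (minpoly (ZMod p) z)) =
      ∑ k : Fin pb.dim, algebraMap (ZMod p) A (Algebra.trace (ZMod p) A (w * z ^ (k : ℕ))) *
        (minpolyDiv (ZMod p) z).coeff k := by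
    conv_lhs => rw [← pb.basis.traceDual.sum_repr w]
    rw [Finset.sum_mul]
    refine Finset.sum_congr rfl fun k _ => ?_
    rw [Module.Basis.traceDual_repr_apply, Module.Basis.traceDual_powerBasis_eq, hgen,
      Algebra.traceForm_apply, pb.basis_eq_pow, hgen, Algebra.smul_def, mul_assoc,
      div_mul_cancel₀ _ hder]
  rw [hw, Fin.sum_univ_eq_sum_range (fun k =>
    algebraMap (ZMod p) A (Algebra.trace (ZMod p) A (w * z ^ k)) *
        (minpolyDiv (ZMod p) z).coeff k), hdim]
  simp only [hc, Finset.mul_sum, ofCoeffs, map_sum, aeval_monomial, map_mul]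
  rw [Finset.sum_comm]
  exact Finset.sum_congr rfl fun m _ => Finset.sum_congr rfl fun k _ => by ring

end PowerProjection

/-! ### Transposed products, and the relation describing a change of generator. -/

section Coefficients

variable {R : Type} [CommRing R]

/-- The correlation sums of the dual basis formula are the coefficients of one ordinary product
after reversal. -/
theorem coeff_reflect_mul_add {n : ℕ} (hn : 0 < n) {t f : R[X]} (ht : t.degree < n) (m : ℕ) :
    (reflect (n - 1) t * f).coeff (n + m) =
      ∑ k ∈ Finset.range n, t.coeff k * f.coeff (k + m + 1) := by
  have h0 : ∀ j, n ≤ j → (reflect (n - 1) t).coeff j = 0 :=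
    fun j hj => (degree_lt_iff_coeff_zero _ _).1 (degree_reflect_lt ht (by omega)) j hj
  rw [coeff_mul, Finset.Nat.sum_antidiagonal_eq_sum_range_succ_mk,
    ← Finset.sum_range_reflect (fun k => t.coeff k * f.coeff (k + m + 1)) n]
  have hsub : Finset.range n ⊆ Finset.range (n + m).succ := Finset.range_subset_range.2 (by omega)
  rw [← Finset.sum_subset hsub]
  · refine Finset.sum_congr rfl fun a ha => ?_
    rw [Finset.mem_range] at ha
    rw [coeff_reflect, revAt_le (by omega)]
    congr 2
    omega
  · intro a _ ha
    rw [Finset.mem_range, not_lt] at ha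
    rw [h0 a ha, zero_mul]

theorem X_pow_dvd_of_dvd_mul [IsDomain R] {q u : R[X]} (hq : q.coeff 0 = 1) {N : ℕ}
    (h : X ^ N ∣ q * u) : X ^ N ∣ u := by
  refine prime_X.pow_dvd_of_dvd_mul_left N ?_ h
  rw [X_dvd_iff, hq]
  exact one_ne_zero

/-- `W` is obtained from `w` by the algorithm that expresses `w y`, where `y` is a root of `Q`,
as a polynomial in the root `z = y ^ e` of `P`; here `V z` is the inverse of `-P' z`. -/
def IsGeneratorChange (n e : ℕ) (Q P V w W : R[X]) : Prop :=
  ∃ t : R[X], t.degree < (e * n : ℕ) ∧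
    X ^ (e * n) ∣ reflect n Q * t - reflect (n - 1) ((w * derivative Q) %ₘ Q) ∧
    W = (-(ofCoeffs n (fun m => (reflect (n - 1) (ofCoeffs n fun k => t.coeff (e * k)) * P).coeff
      (n + m)) * V)) %ₘ P

theorem IsGeneratorChange.map {S : Type} [CommRing S] (φ : R →+* S) {n e : ℕ}
    {Q P V w W : R[X]} (hQ : Q.Monic) (hP : P.Monic) (h : IsGeneratorChange n e Q P V w W) :
    IsGeneratorChange n e (Q.map φ) (P.map φ) (V.map φ) (w.map φ) (W.map φ) := by
  obtain ⟨t, ht, ⟨s, hs⟩, hW⟩ := h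
  refine ⟨t.map φ, degree_map_le.trans_lt ht, ⟨s.map φ, ?_⟩, ?_⟩
  · rw [derivative_map, ← Polynomial.map_mul, ← map_modByMonic _ hQ, reflect_map, reflect_map,
      ← Polynomial.map_mul, ← Polynomial.map_sub, hs, Polynomial.map_mul, Polynomial.map_pow, map_X]
  · rw [hW, map_modByMonic _ hP, Polynomial.map_neg, Polynomial.map_mul, map_ofCoeffs]
    simp_rw [← coeff_map, Polynomial.map_mul, ← reflect_map, map_ofCoeffs, ← coeff_map]

end Coefficients

/-! ### Cost and correctness of the change of generator. -/

section GeneratorChange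

theorem MulCost.derives_generatorChange {K R : Type} [CommRing K] [CommRing R] [Algebra K R]
    {M : ℕ → ℕ} (hM : MulCost K R M) {n e L : ℕ} (hn : 0 < n) (he : 0 < e) (heL : e * n ≤ L)
    (hnL : 2 * n ≤ L) {Q P V w : R[X]} (hQ : Q.Monic) (hQn : Q.natDegree = n) (hP : P.Monic)
    (hPn : P.natDegree = n) (hV : V.degree < n) (hw : w.degree < n) :
    ∃ W : R[X], IsGeneratorChange n e Q P V w W ∧
      Derives K (coeffSet w ∪ coeffSet Q ∪ coeffSet P ∪ coeffSet V) (110 * M L) (coeffSet W) := by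
  have hL : 0 < L := by omega
  have hML := hM.le_self L hL
  have hlt : ∀ {f : R[X]} {m : ℕ}, f.natDegree ≤ m → m < L → f.degree < L := fun h h' =>
    degree_le_natDegree.trans_lt (by exact_mod_cast h.trans_lt h')
  have hwd := natDegree_lt_of_degree_lt hn hw
  have hVd := natDegree_lt_of_degree_lt hn hV
  have hQ' : (derivative Q).natDegree ≤ n - 1 := hQn ▸ natDegree_derivative_le Q
  set a := (w * derivative Q) %ₘ Q with ha
  have had : a.degree < n := by
    rcases subsingleton_or_nontrivial R with _ | _
    · rw [Subsingleton.elim a 0, degree_zero]; exact WithBot.bot_lt_coe n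
    · have := degree_modByMonic_lt (w * derivative Q) hQ
      rwa [degree_eq_natDegree hQ.ne_zero, hQn] at this
  have hq0 : (reflect n Q).coeff 0 = 1 := by
    rw [coeff_reflect, revAt_le (Nat.zero_le _), Nat.sub_zero, ← hQn]
    exact hQ
  have hra : (reflect (n - 1) a).degree < L :=
    degree_lt_of_degree_lt (degree_reflect_lt had (by omega)) (by omega)
  have d1 : Derives K (coeffSet w ∪ coeffSet Q ∪ coeffSet P ∪ coeffSet V) L
      (coeffSet (derivative Q)) :=
    ((derives_derivative hQn.le).mono_left (by intro x hx; simp only [Set.mem_union]; tauto)).mono_cost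
      (by omega)
  have d2 := d1.trans' (hM.derives_mul hL (hlt hwd.le (by omega)) (hlt hQ' (by omega)))
    (by intro x hx; simp only [Set.mem_union] at hx ⊢; tauto)
  have d3 := d2.trans' (hM.derives_modByMonic hQ hL (f := w * derivative Q)
    (hlt (natDegree_mul_le.trans (Nat.add_le_add hwd.le hQ')) (by omega)))
    (by intro x hx; simp only [Set.mem_union] at hx ⊢; tauto)
  obtain ⟨t, ht, hdvd, hd⟩ := hM.derives_series_div (f := reflect (n - 1) a) hq0
    (Nat.mul_pos he hn) heL hra
  have d4 := d3.trans' (hd.mono_left (S' := coeffSet a ∪ coeffSet Q) (Set.union_subset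
    ((coeffSet_reflect_subset _ _).trans fun x hx => Or.inl (Or.inl hx))
    ((coeffSet_reflect_subset _ _).trans fun x hx => Or.inl (Or.inr hx))))
    (by intro x hx; simp only [Set.mem_union] at hx ⊢; tauto)
  set s := ofCoeffs n fun k => t.coeff (e * k) with hs
  have hsd : s.degree < n := degree_ofCoeffs_lt _ _
  have hst : coeffSet s ⊆ coeffSet t ∪ Set.range (algebraMap K R) :=
    coeffSet_ofCoeffs_subset fun k _ => Or.inl (coeff_mem_coeffSet _ _)
  have d5 := d4.trans' ((hM.derives_mul hL (f := reflect (n - 1) s) (g := P)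
    (degree_lt_of_degree_lt (degree_reflect_lt hsd (by omega)) (by omega))
    (hlt hPn.le (by omega))).mono_left (S' := coeffSet t ∪ coeffSet P) (Set.union_subset
      ((coeffSet_reflect_subset _ _).trans (hst.trans (Set.union_subset_union_left _
        Set.subset_union_left))) fun x hx => Or.inl (Or.inr hx)))
    (by intro x hx; simp only [Set.mem_union] at hx ⊢; tauto)
  set b := ofCoeffs n fun m => (reflect (n - 1) s * P).coeff (n + m) with hb
  have hbd := natDegree_lt_of_degree_lt hn (degree_ofCoeffs_lt n
    fun m => (reflect (n - 1) s * P).coeff (n + m))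
  rw [← hb] at hbd
  have hbs : coeffSet b ⊆ coeffSet (reflect (n - 1) s * P) ∪ Set.range (algebraMap K R) :=
    coeffSet_ofCoeffs_subset fun k _ => Or.inl (coeff_mem_coeffSet _ _)
  have d6 := (d5.mono_right hbs).trans' (hM.derives_mul hL (hlt hbd.le (by omega))
    (hlt hVd.le (by omega))) (by intro x hx; simp only [Set.mem_union] at hx ⊢; tauto)
  have hbV : (b * V).degree < L :=
    hlt (natDegree_mul_le.trans (Nat.add_le_add hbd.le (Nat.le_sub_one_of_lt hVd))) (by omega)
  have d7 := d6.trans (derives_neg hbV)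
  have d8 := d7.trans' (hM.derives_modByMonic hP hL (f := -(b * V)) (by rwa [degree_neg]))
    (by intro x hx; simp only [Set.mem_union] at hx ⊢; tauto)
  -- In units of M L: derivative 1, product 1, reduction 36, series division 33, two products 2,
  -- negation 1, reduction 36, in total 110.
  exact ⟨_, ⟨t, ht, hdvd, rfl⟩, d8.mono_cost (by omega)⟩

variable {p : ℕ} [Fact p.Prime] {A : Type} [Field A] [Algebra (ZMod p) A] [Finite A]

theorem eq_of_aeval_eq {y : A} {n : ℕ} (hQn : (minpoly (ZMod p) y).natDegree = n)
    {f g : (ZMod p)[X]} (hf : f.degree < n) (hg : g.degree < n) (h : aeval y f = aeval y g) :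
    f = g := by
  by_contra hne
  have h1 : aeval y (f - g) = 0 := by rw [map_sub, h, sub_self]
  have h2 := minpoly.degree_le_of_ne_zero (ZMod p) y (sub_ne_zero.2 hne) h1
  rw [degree_eq_natDegree (minpoly.ne_zero (Algebra.IsIntegral.isIntegral y)), hQn] at h2
  exact absurd ((degree_sub_le f g).trans_lt (max_lt hf hg)) (not_lt.2 h2)

/-- Below degree n the coefficients agree by Euler's formula for w Q'; from degree n on, the product
vanishes by the linear recurrence that Q(y) = 0 imposes on the traces. -/
theorem X_pow_dvd_power_projection {y : A} (hy : Algebra.adjoin (ZMod p) {y} = ⊤) {n : ℕ}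
    (hn : Module.finrank (ZMod p) A = n) (hn0 : 0 < n) (w : (ZMod p)[X]) (N : ℕ) :
    X ^ N ∣ reflect n (minpoly (ZMod p) y) *
        (ofCoeffs N fun k => Algebra.trace (ZMod p) A (aeval y w * y ^ k)) -
      reflect (n - 1) ((w * derivative (minpoly (ZMod p) y)) %ₘ minpoly (ZMod p) y) := by
  set Q := minpoly (ZMod p) y with hQ
  have hint : IsIntegral (ZMod p) y := Algebra.IsIntegral.isIntegral y
  have hQm : Q.Monic := minpoly.monic hint
  have hQn : Q.natDegree = n := by rw [hQ, natDegree_minpoly_eq_finrank hy, hn]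
  set t : ℕ → ZMod p := fun k => Algebra.trace (ZMod p) A (aeval y w * y ^ k) with ht
  have ha : (w * derivative Q) %ₘ Q = ofCoeffs n fun m => ∑ k ∈ Finset.range n,
      t k * Q.coeff (k + m + 1) := by
    refine eq_of_aeval_eq hQn ?_ (degree_ofCoeffs_lt _ _) ?_
    · have := degree_modByMonic_lt (w * derivative Q) hQm
      rwa [degree_eq_natDegree hQm.ne_zero, hQn] at this
    · rw [← mul_aeval_derivative_minpoly hy hn, modByMonic_eq_sub_mul_div, map_sub, map_mul,
        map_mul, minpoly.aeval, zero_mul, sub_zero]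
  rw [X_pow_dvd_iff]
  intro j hj
  rw [coeff_sub, sub_eq_zero, mul_comm, coeff_mul,
    Finset.Nat.sum_antidiagonal_eq_sum_range_succ_mk]
  have h1 : ∀ k ∈ Finset.range j.succ, (ofCoeffs N t).coeff k * (reflect n Q).coeff (j - k) =
      t k * (reflect n Q).coeff (j - k) := by
    intro k hk
    rw [Finset.mem_range] at hk
    rw [coeff_ofCoeffs, if_pos (by omega)]
  rw [Finset.sum_congr rfl h1]
  by_cases hjn : j < n
  · rw [ha, coeff_reflect, revAt_le (by omega), coeff_ofCoeffs, if_pos (by omega)]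
    have hsub : Finset.range j.succ ⊆ Finset.range n := Finset.range_subset_range.2 (by omega)
    rw [← Finset.sum_subset hsub]
    · refine Finset.sum_congr rfl fun k hk => ?_
      rw [Finset.mem_range] at hk
      rw [coeff_reflect, revAt_le (by omega)]
      congr 2
      omega
    · intro k _ hk
      rw [Finset.mem_range, not_lt] at hk
      rw [coeff_eq_zero_of_natDegree_lt (p := Q) (by omega), mul_zero]
  · obtain ⟨l, rfl⟩ := Nat.exists_eq_add_of_le (not_lt.1 hjn)
    rw [(degree_lt_iff_coeff_zero _ _).1 (degree_reflect_lt (ha ▸ degree_ofCoeffs_lt _ _)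
      (by omega : n - 1 < n)) (n + l) (by omega)]
    have h2 : ∑ c ∈ Finset.range (n + 1), t (c + l) * Q.coeff c = 0 := by
      have h3 : Algebra.trace (ZMod p) A (aeval y w * y ^ l * aeval y Q) = 0 := by
        rw [minpoly.aeval, mul_zero, map_zero]
      rw [aeval_eq_sum_range (p := Q), hQn, Finset.mul_sum, map_sum] at h3
      rw [← h3]
      refine Finset.sum_congr rfl fun c _ => ?_
      rw [mul_smul_comm, map_smul, smul_eq_mul, mul_comm, mul_assoc, ← pow_add, add_comm l c]
    rw [← h2, Nat.succ_eq_add_one, show n + l + 1 = l + (n + 1) by ring, Finset.sum_range_add]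
    rw [Finset.sum_eq_zero, zero_add]
    · refine Finset.sum_congr rfl fun c hc => ?_
      rw [Finset.mem_range] at hc
      rw [coeff_reflect, revAt_le (by omega), add_comm l c]
      congr 2
      omega
    · intro k hk
      rw [Finset.mem_range] at hk
      rw [coeff_reflect, revAt_eq_self_of_lt (by omega), coeff_eq_zero_of_natDegree_lt (by omega),
        mul_zero]

theorem IsGeneratorChange.aeval_eq {y : A} {e n : ℕ} (hy : Algebra.adjoin (ZMod p) {y} = ⊤)
    (hz : Algebra.adjoin (ZMod p) {y ^ e} = ⊤) (hn : Module.finrank (ZMod p) A = n) (he : 0 < e)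
    {V w W : (ZMod p)[X]}
    (hV : aeval (y ^ e) V * aeval (y ^ e) (derivative (minpoly (ZMod p) (y ^ e))) = -1)
    (h : IsGeneratorChange n e (minpoly (ZMod p) y) (minpoly (ZMod p) (y ^ e)) V w W) :
    aeval (y ^ e) W = aeval y w := by
  obtain ⟨t, ht, hdvd, rfl⟩ := h
  have hn0 : 0 < n := hn ▸ Module.finrank_pos
  have hint : IsIntegral (ZMod p) y := Algebra.IsIntegral.isIntegral y
  have hQn := (natDegree_minpoly_eq_finrank hy).trans hn
  -- Both sides solve the same congruence modulo X^(e n), and the reversal of Q has constant term 1,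
  -- so the solution is unique.
  have ht' : t = ofCoeffs (e * n) fun k => Algebra.trace (ZMod p) A (aeval y w * y ^ k) := by
    have h1 := X_pow_dvd_power_projection hy hn hn0 w (e * n)
    set T := ofCoeffs (e * n) fun k => Algebra.trace (ZMod p) A (aeval y w * y ^ k) with hT
    have h2 := dvd_sub hdvd h1
    rw [sub_sub_sub_cancel_right, ← mul_sub] at h2
    have h3 : X ^ (e * n) ∣ t - T := by
      refine X_pow_dvd_of_dvd_mul ?_ h2
      rw [coeff_reflect, revAt_le (Nat.zero_le _), Nat.sub_zero, ← hQn]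
      exact minpoly.monic hint
    rw [eq_ofCoeffs_of_X_pow_dvd_sub ht h3, ofCoeffs_coeff_of_degree_lt (degree_ofCoeffs_lt _ _)]
  have hs : (ofCoeffs n fun k => t.coeff (e * k)) =
      ofCoeffs n fun k => Algebra.trace (ZMod p) A (aeval y w * (y ^ e) ^ k) := by
    ext k
    rw [coeff_ofCoeffs, coeff_ofCoeffs, ht', coeff_ofCoeffs]
    split_ifs with h1 h2
    · rw [pow_mul]
    · exact absurd (Nat.mul_lt_mul_of_pos_left h1 he) h2
    · rfl
  rw [modByMonic_eq_sub_mul_div, map_sub, map_mul, minpoly.aeval, zero_mul, sub_zero, map_neg,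
    map_mul, hs]
  simp_rw [coeff_reflect_mul_add hn0 (degree_ofCoeffs_lt n _)]
  have hB : (ofCoeffs n fun m => ∑ k ∈ Finset.range n,
      (ofCoeffs n fun k => Algebra.trace (ZMod p) A (aeval y w * (y ^ e) ^ k)).coeff k *
        (minpoly (ZMod p) (y ^ e)).coeff (k + m + 1)) = ofCoeffs n fun m => ∑ k ∈ Finset.range n,
      Algebra.trace (ZMod p) A (aeval y w * (y ^ e) ^ k) *
        (minpoly (ZMod p) (y ^ e)).coeff (k + m + 1) := by
    congr 1
    funext m
    refine Finset.sum_congr rfl fun k hk => ?_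
    rw [coeff_ofCoeffs, if_pos (Finset.mem_range.1 hk)]
  rw [hB, ← mul_aeval_derivative_minpoly hz hn]
  linear_combination -(aeval y w) * hV

end GeneratorChange

/-! ### Push-down and lift-up over the ring of coefficients -/

section Generic

variable {R : Type} [CommRing R]

theorem monic_X_pow_add_ofCoeffs [Nontrivial R] (n : ℕ) (u : ℕ → R) :
    (X ^ n + ofCoeffs n u).Monic ∧ (X ^ n + ofCoeffs n u).natDegree = n := by
  have h := degree_ofCoeffs_lt n u
  refine ⟨monic_X_pow_add h, ?_⟩
  refine natDegree_eq_of_degree_eq_some ?_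
  rw [degree_add_eq_left_of_degree_lt (by rwa [degree_X_pow]), degree_X_pow]

theorem degree_expand_lt {e n L : ℕ} (he : 0 < e) (hL : e * n ≤ L) {f : R[X]} (hf : f.degree < n) :
    (expand R e f).degree < L := by
  rw [degree_lt_iff_coeff_zero] at hf ⊢
  intro k hk
  rw [coeff_expand he]
  split_ifs with h
  · obtain ⟨j, rfl⟩ := h
    rw [Nat.mul_div_cancel_left _ he]
    exact hf j (Nat.le_of_mul_le_mul_left (hL.trans hk) he)
  · rfl

variable {K : Type} [CommRing K] [Algebra K R]

theorem coeffSet_expand_subset {e : ℕ} (he : 0 < e) (f : R[X]) :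
    coeffSet (expand R e f) ⊆ coeffSet f ∪ Set.range (algebraMap K R) := by
  rw [coeffSet_subset_iff]
  intro k
  rw [coeff_expand he]
  split_ifs
  · exact Or.inl (coeff_mem_coeffSet _ _)
  · exact zero_mem_union_range _

theorem coeffSet_X_pow_add_subset {S : Set R} (n : ℕ) {f : R[X]} (hf : f.degree < n)
    (hS : coeffSet f ⊆ S ∪ Set.range (algebraMap K R)) :
    coeffSet (X ^ n + f) ⊆ S ∪ Set.range (algebraMap K R) := by
  rw [coeffSet_subset_iff] at hS ⊢
  intro k
  rw [coeff_add, coeff_X_pow]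
  split_ifs with h
  · rw [h, (degree_lt_iff_coeff_zero _ _).1 hf n le_rfl, add_zero]
    exact one_mem_union_range _
  · rw [zero_add]
    exact hS k

theorem Derives.iUnion_fin {S : Set R} {c m : ℕ} {T : Fin m → Set R}
    (h : ∀ b, Derives K S c (T b)) : Derives K S (m * c) (⋃ b, T b) := by
  have := Derives.iUnion_lt (K := K) (S := S) (c := c) m
    (fun b => if hb : b < m then T ⟨b, hb⟩ else ∅) fun b hb => by simpa [hb] using h ⟨b, hb⟩
  refine this.mono_right (Set.iUnion_subset fun b => ?_)
  intro x hx
  refine Or.inl (Set.mem_iUnion.2 ⟨b, Set.mem_iUnion.2 ⟨b.2, ?_⟩⟩)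
  simpa using hx

variable {p : ℕ} [Fact p.Prime] [CharP R p] {M : ℕ → ℕ}

/-- One base change, then p reductions of polynomials of degree below e n ≤ 2 p n. Each reduction
costs 36 M(2pn) ≤ 144 M(pn). -/
theorem MulCost.derives_pushDown (hM : MulCost K R M) {n e : ℕ} (hn : 0 < n) (he : 0 < e)
    (hep : e ≤ 2 * p - 1) {Q f : R[X]} (hQ : Q.Monic) (hf : f.degree < (p * n : ℕ)) :
    ∃ W : Fin p → R[X], f = baseEval W ∧
      Derives K (coeffSet f ∪ coeffSet Q)
        (440 * (p * (p * n) * Nat.log p (p * n) ^ 2 + p * M (p * n)))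
        (⋃ b, coeffSet (expand R e (W b) %ₘ Q)) := by
  have hp : p.Prime := Fact.out
  have hN : 0 < p * n := Nat.mul_pos hp.pos hn
  obtain ⟨W, hW, hWb, hWd⟩ := exists_baseEval_eq K (Nat.log p (p * n)) (p * n) f hf
    (Nat.lt_pow_succ_log_self hp.one_lt _).le
  refine ⟨W, hW, ?_⟩
  have hL : e * n ≤ 2 * (p * n) := by
    rw [← mul_assoc]; exact Nat.mul_le_mul_right n (by omega)
  have h1 : ∀ b, Derives K (coeffSet f ∪ coeffSet Q ∪ ⋃ b, coeffSet (W b)) (36 * M (2 * (p * n)))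
      (coeffSet (expand R e (W b) %ₘ Q)) := by
    intro b
    refine (hM.derives_modByMonic hQ (by omega) (degree_expand_lt he hL (hWb.degree_lt b))).mono_left
      (Set.union_subset ((coeffSet_expand_subset (K := K) he _).trans ?_) ?_)
    · refine Set.union_subset_union_left _ ?_
      exact fun x hx => Or.inr (Set.mem_iUnion.2 ⟨b, hx⟩)
    · exact fun x hx => Or.inl (Or.inl (Or.inr hx))
  have h2 := (hWd.mono_left (S' := coeffSet f ∪ coeffSet Q) fun x hx => Or.inl (Or.inl hx)).trans'
    (Derives.iUnion_fin h1) Set.subset_union_left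
  refine h2.mono_cost ?_
  have h3 := hM.mul_le 2 (p * n) (by omega) hN
  have h4 : p * (36 * M (2 * (p * n))) ≤ 440 * (p * M (p * n)) := by
    calc p * (36 * M (2 * (p * n))) ≤ p * (36 * (2 ^ 2 * M (p * n))) := by gcongr
      _ = 144 * (p * M (p * n)) := by ring
      _ ≤ _ := by gcongr; norm_num
  have h5 : Nat.log p (p * n) ≤ Nat.log p (p * n) ^ 2 := Nat.le_self_pow (by norm_num) _
  have h6 : Nat.log p (p * n) * p * (p * n) ≤
      440 * (p * (p * n) * Nat.log p (p * n) ^ 2) := by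
    calc Nat.log p (p * n) * p * (p * n) ≤ Nat.log p (p * n) ^ 2 * p * (p * n) := by gcongr
      _ = 1 * (p * (p * n) * Nat.log p (p * n) ^ 2) := by ring
      _ ≤ _ := by gcongr; norm_num
  omega

/-- `f` is the result of the lift-up of `∑ b, w b * X ^ b`: here `Q` and `F` are the defining
polynomials of the two levels, and `G` is the inverse of the derivative of `F`. -/
def IsLiftUp (n e : ℕ) (Q F G : R[X]) (w : Fin p → R[X]) (f : R[X]) : Prop :=
  ∃ (U V W : Fin p → R[X]) (b₀ : Fin p), (b₀ : ℕ) = 0 ∧ F = baseEval U ∧ G = baseEval V ∧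
    (∀ b, IsGeneratorChange n e Q (X ^ n + ofCoeffs n (U b₀).coeff) (V b₀) (w b) (W b)) ∧
    (∀ b, (W b).degree < n) ∧ f = baseEval W

/-- Two base changes supply the data for the generator z, p changes of generator give the digits,
and one inverse base change assembles f. The constant is 440 = 4 · 110, from M(2N) ≤ 4 M(N). -/
theorem MulCost.derives_liftUp [Nontrivial R] (hM : MulCost K R M) {n e : ℕ} (hn : 0 < n)
    (he : 0 < e) (hep : e ≤ 2 * p - 1) {Q F G : R[X]} {w : Fin p → R[X]} (hQ : Q.Monic)
    (hQn : Q.natDegree = n) (hF : F.degree < (p * n + 1 : ℕ)) (hG : G.degree < (p * n : ℕ))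
    (hw : ∀ b, (w b).degree < n) :
    ∃ f : R[X], IsLiftUp n e Q F G w f ∧
      Derives K ((⋃ b, coeffSet (w b)) ∪ coeffSet Q ∪ coeffSet F ∪ coeffSet G)
        (440 * (p * (p * n) * Nat.log p (p * n) ^ 2 + p * M (p * n))) (coeffSet f) := by
  have hp : p.Prime := Fact.out
  have hp2 := hp.two_le
  have hN : 0 < p * n := Nat.mul_pos hp.pos hn
  set N := p * n with hNdef
  set ℓ := Nat.log p N with hℓ
  have hNℓ : N < p ^ (ℓ + 1) := Nat.lt_pow_succ_log_self hp.one_lt _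
  -- F has degree up to N, hence N + 1 coefficients; the strict inequality N < p^(ℓ+1) leaves room
  -- for the extra one.
  obtain ⟨U, hU, -, hUd⟩ := exists_baseEval_eq K ℓ (N + 1) F hF hNℓ
  obtain ⟨V, hV, hVb, hVd⟩ := exists_baseEval_eq K ℓ N G hG hNℓ.le
  let b₀ : Fin p := ⟨0, hp.pos⟩
  -- The leading coefficient is imposed, so that P is monic over R; at genuine inputs the zeroth
  -- digit of F is already monic of degree n.
  set P := X ^ n + ofCoeffs n (U b₀).coeff with hP
  obtain ⟨hPm, hPn⟩ := monic_X_pow_add_ofCoeffs n (U b₀).coeff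
  have hL : e * n ≤ 2 * N := by
    rw [hNdef, ← mul_assoc]; exact Nat.mul_le_mul_right n (by omega)
  have hL' : 2 * n ≤ 2 * N := by
    have : 1 * n ≤ p * n := Nat.mul_le_mul_right n (by omega)
    omega
  choose W hW hWd using fun b => hM.derives_generatorChange hn he hL hL' hQ hQn hPm hPn
    (hVb.degree_lt b₀) (hw b)
  have hWdeg : ∀ b, (W b).degree < n := by
    intro b
    obtain ⟨t, -, -, h⟩ := hW b
    rw [h]
    have := degree_modByMonic_lt (-(ofCoeffs n (fun m => (reflect (n - 1)
      (ofCoeffs n fun k => t.coeff (e * k)) * P).coeff (n + m)) * V b₀)) hPm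
    rwa [degree_eq_natDegree hPm.ne_zero, hPn] at this
  refine ⟨baseEval W, ⟨U, V, W, b₀, rfl, hU, hV, hW, hWdeg, rfl⟩, ?_⟩
  set S := (⋃ b, coeffSet (w b)) ∪ coeffSet Q ∪ coeffSet F ∪ coeffSet G with hS
  have d1 : Derives K S (ℓ * p * (N + 1)) (⋃ b, coeffSet (U b)) :=
    hUd.mono_left fun x hx => Or.inl (Or.inl (Or.inr hx))
  have d2 : Derives K S (ℓ * p * N) (⋃ b, coeffSet (V b)) :=
    hVd.mono_left fun x hx => Or.inl (Or.inr hx)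
  have d3 := (d1.union d2).trans' (Derives.iUnion_fin fun b => (hWd b).mono_left
    (S' := S ∪ ((⋃ b, coeffSet (U b)) ∪ ⋃ b, coeffSet (V b))) (by
      refine Set.union_subset (Set.union_subset (Set.union_subset ?_ ?_) ?_) ?_
      · exact fun x hx => Or.inl (Or.inl (Or.inl (Or.inl (Or.inl (Set.mem_iUnion.2 ⟨b, hx⟩)))))
      · exact fun x hx => Or.inl (Or.inl (Or.inl (Or.inl (Or.inr hx))))
      · refine coeffSet_X_pow_add_subset n (degree_ofCoeffs_lt _ _)
          (coeffSet_ofCoeffs_subset fun k _ => ?_)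
        exact Or.inl (Or.inr (Or.inl (Set.mem_iUnion.2 ⟨b₀, coeff_mem_coeffSet _ _⟩)))
      · exact fun x hx => Or.inl (Or.inr (Or.inr (Set.mem_iUnion.2 ⟨b₀, hx⟩)))))
    Set.subset_union_left
  have d4 := d3.trans (derives_baseEval K ℓ N W (digitBound_of_degree_lt hWdeg) hNℓ.le).2
  refine d4.mono_cost ?_
  have h3 := hM.mul_le 2 N (by omega) hN
  have h4 : p * (110 * M (2 * N)) ≤ 440 * (p * M N) := by
    calc p * (110 * M (2 * N)) ≤ p * (110 * (2 ^ 2 * M N)) := by gcongr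
      _ = 440 * (p * M N) := by ring
  have h5 : ℓ ≤ ℓ ^ 2 := Nat.le_self_pow (by norm_num) _
  have h6 : ℓ * p * (N + 1) + ℓ * p * N + 2 * (ℓ * p * N) ≤ 440 * (p * N * ℓ ^ 2) := by
    calc ℓ * p * (N + 1) + ℓ * p * N + 2 * (ℓ * p * N)
        ≤ ℓ * p * (N + N) + ℓ * p * N + 2 * (ℓ * p * N) := by gcongr; omega
      _ = 5 * (p * N * ℓ) := by ring
      _ ≤ 440 * (p * N * ℓ ^ 2) := by gcongr; norm_num
  omega

end Generic

/-! ### Correctness of the lift-up -/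

section Correctness

variable {p : ℕ}

theorem IsLiftUp.map {R S : Type} [CommRing R] [CommRing S] [Nontrivial R] (φ : R →+* S) {n e : ℕ}
    {Q F G f : R[X]} {w : Fin p → R[X]} (hQ : Q.Monic) (h : IsLiftUp n e Q F G w f) :
    IsLiftUp n e (Q.map φ) (F.map φ) (G.map φ) (fun b => (w b).map φ) (f.map φ) := by
  obtain ⟨U, V, W, b₀, hb₀, rfl, rfl, hW, hWd, rfl⟩ := h
  refine ⟨fun b => (U b).map φ, fun b => (V b).map φ, fun b => (W b).map φ, b₀, hb₀,
    map_baseEval φ U, map_baseEval φ V, fun b => ?_, fun b => degree_map_le.trans_lt (hWd b),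
    map_baseEval φ W⟩
  have := (hW b).map φ hQ (monic_X_pow_add_ofCoeffs n _).1
  rw [Polynomial.map_add, Polynomial.map_pow, map_X, map_ofCoeffs] at this
  simp_rw [← coeff_map] at this
  exact this

theorem X_pow_add_ofCoeffs_of_monic {R : Type} [CommRing R] {n : ℕ} {f : R[X]} (hf : f.Monic)
    (hn : f.natDegree = n) : X ^ n + ofCoeffs n f.coeff = f := by
  ext k
  rw [coeff_add, coeff_X_pow, coeff_ofCoeffs]
  rcases lt_trichotomy k n with h | h | h
  · rw [if_neg h.ne, if_pos h, zero_add]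
  · rw [if_pos h, if_neg (by omega), add_zero, h, ← hn]
    exact hf.symm
  · rw [if_neg (by omega), if_neg (by omega), coeff_eq_zero_of_natDegree_lt (by omega), zero_add]

variable [Fact p.Prime] {A B : Type} [Field A] [Algebra (ZMod p) A]
  [Field B] [Algebra (ZMod p) B] [Algebra A B] [IsScalarTower (ZMod p) A B]

theorem aeval_baseEval {x : B} {z : A} (hx : x ^ p - x = algebraMap A B z)
    (W : Fin p → (ZMod p)[X]) :
    aeval x (baseEval W) = ∑ b, algebraMap A B (aeval z (W b)) * x ^ (b : ℕ) := by
  rw [baseEval, map_sum]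
  refine Finset.sum_congr rfl fun b _ => ?_
  rw [map_mul, map_pow, aeval_X, aeval_comp, map_sub, map_pow, aeval_X, hx, aeval_algebraMap_apply,
    mul_comm]

theorem aeval_pushDown {x : B} {y : A} {e : ℕ} (hx : x ^ p - x = algebraMap A B (y ^ e))
    (W : Fin p → (ZMod p)[X]) :
    aeval x (baseEval W) = ∑ b, algebraMap A B
      (aeval y (expand (ZMod p) e (W b) %ₘ minpoly (ZMod p) y)) * x ^ (b : ℕ) := by
  rw [aeval_baseEval hx]
  refine Finset.sum_congr rfl fun b _ => ?_
  rw [modByMonic_eq_sub_mul_div, map_sub, map_mul, minpoly.aeval, zero_mul, sub_zero, expand_aeval]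

variable [Finite A] [Finite B]

/-- The composite is monic, vanishes at x and has degree p [A : 𝔽_p] = [B : 𝔽_p], the degree of the
minimal polynomial of x. -/
theorem minpoly_comp {x : B} {z : A} (hx : x ^ p - x = algebraMap A B z)
    (hz : Algebra.adjoin (ZMod p) {z} = ⊤) (hxt : Algebra.adjoin (ZMod p) {x} = ⊤)
    (hdim : Module.finrank A B = p) :
    (minpoly (ZMod p) z).comp (X ^ p - X) = minpoly (ZMod p) x := by
  have hp : p.Prime := Fact.out
  obtain ⟨hm, hd⟩ := monic_X_pow_sub_X (R := ZMod p) hp.one_lt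
  have hzm := minpoly.monic (A := ZMod p) (Algebra.IsIntegral.isIntegral z)
  refine eq_of_monic_of_dvd_of_natDegree_le
    (minpoly.monic (Algebra.IsIntegral.isIntegral x)) (hzm.comp hm (by rw [hd]; exact hp.ne_zero))
    (minpoly.dvd _ _ ?_) ?_
  · rw [aeval_comp, map_sub, map_pow, aeval_X, hx, aeval_algebraMap_apply, minpoly.aeval, map_zero]
  · rw [natDegree_comp, hd, natDegree_minpoly_eq_finrank hz, natDegree_minpoly_eq_finrank hxt,
      ← Module.finrank_mul_finrank (ZMod p) A B, hdim]

theorem IsLiftUp.aeval_eq {pb : PowerBasis A B} {y : A} {e n : ℕ}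
    (hpb : minpoly A pb.gen = X ^ p - X - C (y ^ e)) (hy : Algebra.adjoin (ZMod p) {y} = ⊤)
    (hz : Algebra.adjoin (ZMod p) {y ^ e} = ⊤) (hx : Algebra.adjoin (ZMod p) {pb.gen} = ⊤)
    (hn : Module.finrank (ZMod p) A = n) (he : 0 < e) {G f : (ZMod p)[X]}
    (hG : minpoly (ZMod p) pb.gen ∣ G * derivative (minpoly (ZMod p) pb.gen) - 1)
    {w : Fin p → (ZMod p)[X]}
    (h : IsLiftUp n e (minpoly (ZMod p) y) (minpoly (ZMod p) pb.gen) G w f) :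
    f.degree < (p * n : ℕ) ∧
      aeval pb.gen f = ∑ b, algebraMap A B (aeval y (w b)) * pb.gen ^ (b : ℕ) := by
  have hp : p.Prime := Fact.out
  obtain ⟨U, V, W, b₀, hb₀, hU, hV, hW, hWd, rfl⟩ := h
  have : FiniteDimensional A B := pb.finite
  set x := pb.gen with hxdef
  have hxz : x ^ p - x = algebraMap A B (y ^ e) := by
    have := minpoly.aeval A x
    simp only [hpb, map_sub, map_pow, aeval_X, aeval_C] at this
    rw [map_pow]
    linear_combination this
  have hdim' : pb.dim = p := by
    rw [← pb.natDegree_minpoly, hpb, (artinSchreier_monic hp.one_lt (y ^ e)).2]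
  have hdim : Module.finrank A B = p := by rw [pb.finrank, hdim']
  set P := minpoly (ZMod p) (y ^ e) with hP
  have hcomp : P.comp (X ^ p - X) = minpoly (ZMod p) x := minpoly_comp hxz hz hx hdim
  have hPm : P.Monic := minpoly.monic (Algebra.IsIntegral.isIntegral _)
  have hPn : P.natDegree = n := (natDegree_minpoly_eq_finrank hz).trans hn
  -- P(X^p - X) has the digits P, 0, …, 0, and digits are unique.
  have hU0 : U b₀ = P := by
    have h1 : baseEval (fun b => if b = b₀ then P else 0) = minpoly (ZMod p) x := by
      rw [baseEval, Finset.sum_eq_single b₀]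
      · rw [if_pos rfl, hb₀, pow_zero, one_mul, hcomp]
      · intro b _ hb
        rw [if_neg hb, zero_comp, mul_zero]
      · intro hb
        exact absurd (Finset.mem_univ _) hb
    have h2 := eq_zero_of_baseEval_eq_zero hp.one_lt
      (fun b => U b - if b = b₀ then P else 0) (by rw [baseEval_sub, h1, ← hU, sub_self]) b₀
    rwa [if_pos rfl, sub_eq_zero] at h2
  -- Evaluating at x, where Q_i' takes the value -P'(z) ∈ A, the relation becomes -P'(z) ∑_b V_b(z)
  -- x^b = 1. Comparing coefficients of x^0 over A isolates the zeroth digit.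
  have hVz : aeval (y ^ e) (V b₀) * aeval (y ^ e) (derivative P) = -1 := by
    have h1 : aeval x G * aeval x (derivative (minpoly (ZMod p) x)) = 1 := by
      obtain ⟨s, hs⟩ := hG
      have := congrArg (aeval x) hs
      rw [map_mul, minpoly.aeval, zero_mul, map_sub, map_mul, map_one, sub_eq_zero] at this
      exact this
    have h2 : aeval x (derivative (minpoly (ZMod p) x)) =
        -algebraMap A B (aeval (y ^ e) (derivative P)) := by
      have h3 : derivative (X ^ p - X : (ZMod p)[X]) = -1 := by
        rw [derivative_sub, derivative_X_pow, derivative_X, CharP.cast_eq_zero]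
        simp
      rw [← hcomp, derivative_comp, h3, map_mul, aeval_comp, map_sub, map_pow, aeval_X, hxz,
        aeval_algebraMap_apply, map_neg, map_one, neg_one_mul]
    rw [h2, hV, aeval_baseEval hxz] at h1
    set r := aeval (y ^ e) (derivative P) with hr
    have h3 : ∑ b : Fin p, (aeval (y ^ e) (V b) * r + if b = b₀ then 1 else 0) • x ^ (b : ℕ) = 0 := by
      simp only [add_smul, Finset.sum_add_distrib, ite_smul, one_smul, zero_smul,
        Finset.sum_ite_eq', Finset.mem_univ, if_true, hb₀, pow_zero]
      simp only [Algebra.smul_def, map_mul]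
      rw [← neg_eq_iff_add_eq_zero, ← h1, mul_neg, Finset.sum_mul]
      congr 1
      exact Finset.sum_congr rfl fun b _ => by ring
    have hli : LinearIndependent A fun b : Fin p => x ^ (b : ℕ) := by
      have := pb.basis.linearIndependent
      rw [pb.coe_basis] at this
      exact this.comp (finCongr hdim'.symm) (finCongr hdim'.symm).injective
    have h4 := Fintype.linearIndependent_iff.1 hli _ h3 b₀
    rw [if_pos rfl] at h4
    linear_combination h4
  refine ⟨(derives_baseEval (ZMod p) (Nat.log p (p * n)) (p * n) W (digitBound_of_degree_lt hWd)
    (Nat.lt_pow_succ_log_self hp.one_lt _).le).1, ?_⟩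
  rw [aeval_baseEval hxz]
  refine Finset.sum_congr rfl fun b _ => ?_
  have h1 := hW b
  rw [hU0, X_pow_add_ofCoeffs_of_monic hPm hPn] at h1
  rw [h1.aeval_eq hy hz hn he hVz]

end Correctness

/-! ### The straight-line programs -/

section PolyOf

variable {R : Type} [CommRing R]

theorem polyOf_eq_ofCoeffs {n : ℕ} (a : Fin n → R) :
    polyOf a = ofCoeffs n fun k => if h : k < n then a ⟨k, h⟩ else 0 := by
  rw [polyOf, ofCoeffs,
    ← Fin.sum_univ_eq_sum_range (fun j => monomial j (if h : j < n then a ⟨j, h⟩ else 0)) n]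
  simp [C_mul_X_pow_eq_monomial]

theorem degree_polyOf_lt {n : ℕ} (a : Fin n → R) : (polyOf a).degree < n := by
  rw [polyOf_eq_ofCoeffs]
  exact degree_ofCoeffs_lt _ _

theorem map_polyOf {S : Type} [CommRing S] (φ : R →+* S) {n : ℕ} (a : Fin n → R) :
    (polyOf a).map φ = polyOf fun k => φ (a k) := by
  simp [polyOf, Polynomial.map_sum]

theorem coeffSet_polyOf_subset {K : Type} [CommRing K] [Algebra K R] {n : ℕ} (a : Fin n → R)
    {S : Set R} (h : ∀ k, a k ∈ S) : coeffSet (polyOf a) ⊆ S ∪ Set.range (algebraMap K R) := by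
  rw [polyOf_eq_ofCoeffs]
  refine coeffSet_ofCoeffs_subset fun k hk => Or.inl ?_
  rw [dif_pos hk]
  exact h _

theorem monic_X_pow_add_polyOf [Nontrivial R] {n : ℕ} (a : Fin n → R) :
    (X ^ n + polyOf a).Monic ∧ (X ^ n + polyOf a).natDegree = n := by
  rw [polyOf_eq_ofCoeffs]
  exact monic_X_pow_add_ofCoeffs _ _

theorem X_pow_add_polyOf_of_monic {n : ℕ} {f : R[X]} (hf : f.Monic) (hn : f.natDegree = n) :
    X ^ n + polyOf (fun k : Fin n => f.coeff k) = f := by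
  conv_rhs => rw [← X_pow_add_ofCoeffs_of_monic hf hn]
  congr 1
  rw [polyOf_eq_ofCoeffs]
  ext k
  rw [coeff_ofCoeffs, coeff_ofCoeffs]
  split_ifs <;> rfl

end PolyOf

/-! ### Programs with all coordinates and precomputed data as variables. -/

section Programs

variable {p : ℕ} [Fact p.Prime] {M : ℕ → ℕ}

instance charP_functions {ι : Type} : CharP ((ι → ZMod p) → ZMod p) p :=
  charP_of_injective_algebraMap (algebraMap (ZMod p) ((ι → ZMod p) → ZMod p)).injective p

/-- The cost of push-down and of lift-up in degree `N`. -/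
def towerCost (p : ℕ) (M : ℕ → ℕ) (N : ℕ) : ℕ := 440 * (p * N * Nat.log p N ^ 2 + p * M N)

/-- The derivation is carried out once over the ring of functions and then specialized by evaluation
at (c, t). The program is chosen before c and t, hence independently of Q₀. -/
theorem exists_pushDown_program (hM : IsMulFunction (ZMod p) M) {n e N : ℕ} (hn : 0 < n)
    (he : 0 < e) (hep : e ≤ 2 * p - 1) (hN : N = p * n) :
    ∃ P : SLP (ZMod p) (Fin N ⊕ PreIndex p n N) (Fin n × Fin p), P.cost ≤ towerCost p M N ∧
      ∀ (c : Fin N → ZMod p) (t : PreIndex p n N → ZMod p), ∃ W : Fin p → (ZMod p)[X],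
        polyOf c = baseEval W ∧ ∀ ab, P.eval (Sum.elim c t) ab =
          (expand (ZMod p) e (W ab.2) %ₘ (X ^ n + polyOf fun a => t (.lowerPoly a))).coeff ab.1 := by
  subst hN
  let ι := Fin (p * n) ⊕ PreIndex p n (p * n)
  let R := (ι → ZMod p) → ZMod p
  let v : ι → R := fun i x => x i
  have hMR : MulCost (ZMod p) R M := hM.mulCost
  let f : R[X] := polyOf fun k => v (.inl k)
  let Q : R[X] := X ^ n + polyOf fun a => v (.inr (.lowerPoly a))
  have hQ : Q.Monic := (monic_X_pow_add_polyOf _).1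
  obtain ⟨W, hW, hd⟩ := hMR.derives_pushDown hn he hep hQ (f := f) (degree_polyOf_lt _)
  have hd' := (hd.mono_left (S' := Set.range v) (Set.union_subset
    (coeffSet_polyOf_subset _ fun k => ⟨_, rfl⟩)
    (coeffSet_X_pow_add_subset n (degree_polyOf_lt _)
      (coeffSet_polyOf_subset _ fun k => ⟨_, rfl⟩)))).mono_right
    (T' := Set.range fun ab : Fin n × Fin p => (expand R e (W ab.2) %ₘ Q).coeff ab.1) (by
      rintro _ ⟨ab, rfl⟩
      exact Or.inl (Set.mem_iUnion.2 ⟨ab.2, coeff_mem_coeffSet _ _⟩))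
  obtain ⟨P, hP, hPe⟩ := hd'.exists_program
  refine ⟨P, hP, fun c t => ?_⟩
  let ev : R →+* ZMod p := Pi.evalRingHom _ (Sum.elim c t)
  have hQe : Q.map ev = X ^ n + polyOf fun a => t (.lowerPoly a) := by
    rw [Polynomial.map_add, Polynomial.map_pow, map_X, map_polyOf]; rfl
  refine ⟨fun b => (W b).map ev, ?_, fun ab => ?_⟩
  · rw [← map_baseEval, ← hW, map_polyOf]; rfl
  · rw [hPe, ← hQe, ← map_expand, ← map_modByMonic _ hQ, coeff_map]; rfl

theorem exists_liftUp_program (hM : IsMulFunction (ZMod p) M) {n e N : ℕ} (hn : 0 < n)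
    (he : 0 < e) (hep : e ≤ 2 * p - 1) (hN : N = p * n) :
    ∃ P : SLP (ZMod p) ((Fin n × Fin p) ⊕ PreIndex p n N) (Fin N), P.cost ≤ towerCost p M N ∧
      ∀ (c : Fin n × Fin p → ZMod p) (t : PreIndex p n N → ZMod p), ∃ f : (ZMod p)[X],
        IsLiftUp n e (X ^ n + polyOf fun a => t (.lowerPoly a))
          (X ^ N + polyOf fun a => t (.upperPoly a)) (polyOf fun a => t (.derivInv a))
          (fun b : Fin p => polyOf fun a => c (a, b)) f ∧
        ∀ k : Fin N, P.eval (Sum.elim c t) k = f.coeff k := by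
  subst hN
  let ι := (Fin n × Fin p) ⊕ PreIndex p n (p * n)
  let R := (ι → ZMod p) → ZMod p
  let v : ι → R := fun i x => x i
  have hMR : MulCost (ZMod p) R M := hM.mulCost
  let Q : R[X] := X ^ n + polyOf fun a => v (.inr (.lowerPoly a))
  let F : R[X] := X ^ (p * n) + polyOf fun a => v (.inr (.upperPoly a))
  let G : R[X] := polyOf fun a => v (.inr (.derivInv a))
  let w : Fin p → R[X] := fun b => polyOf fun a => v (.inl (a, b))
  obtain ⟨hQ, hQn⟩ : Q.Monic ∧ Q.natDegree = n := monic_X_pow_add_polyOf _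
  obtain ⟨hF, hFn⟩ : F.Monic ∧ F.natDegree = p * n := monic_X_pow_add_polyOf _
  obtain ⟨f, hf, hd⟩ := hMR.derives_liftUp hn he hep hQ hQn (F := F) (G := G) (w := w)
    (degree_le_natDegree.trans_lt (by rw [hFn]; exact_mod_cast Nat.lt_succ_self _))
    (degree_polyOf_lt _) (fun b => degree_polyOf_lt _)
  have hd' := (hd.mono_left (S' := Set.range v) (by
    refine Set.union_subset (Set.union_subset (Set.union_subset (Set.iUnion_subset fun b => ?_) ?_)
      ?_) ?_
    · exact coeffSet_polyOf_subset _ fun k => ⟨_, rfl⟩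
    · exact coeffSet_X_pow_add_subset n (degree_polyOf_lt _)
        (coeffSet_polyOf_subset _ fun k => ⟨_, rfl⟩)
    · exact coeffSet_X_pow_add_subset (p * n) (degree_polyOf_lt _)
        (coeffSet_polyOf_subset _ fun k => ⟨_, rfl⟩)
    · exact coeffSet_polyOf_subset _ fun k => ⟨_, rfl⟩)).mono_right
    (T' := Set.range fun k : Fin (p * n) => f.coeff k) (by
      rintro _ ⟨k, rfl⟩
      exact Or.inl (coeff_mem_coeffSet _ _))
  obtain ⟨P, hP, hPe⟩ := hd'.exists_program
  refine ⟨P, hP, fun c t => ?_⟩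
  let ev : R →+* ZMod p := Pi.evalRingHom _ (Sum.elim c t)
  have h1 := hf.map ev hQ
  have hQe : Q.map ev = X ^ n + polyOf fun a => t (.lowerPoly a) := by
    rw [Polynomial.map_add, Polynomial.map_pow, map_X, map_polyOf]; rfl
  have hFe : F.map ev = X ^ (p * n) + polyOf fun a => t (.upperPoly a) := by
    rw [Polynomial.map_add, Polynomial.map_pow, map_X, map_polyOf]; rfl
  have hGe : G.map ev = polyOf fun a => t (.derivInv a) := by
    rw [map_polyOf]; rfl
  have hwe : (fun b => (w b).map ev) = fun b => polyOf fun a => c (a, b) := by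
    funext b
    rw [map_polyOf]; rfl
  rw [hQe, hFe, hGe, hwe] at h1
  refine ⟨f.map ev, h1, fun k => ?_⟩
  rw [hPe, coeff_map]; rfl

end Programs

/-! ### The two bases and the precomputed quantities -/

section Main

theorem towerCost_le (p : ℕ) (M : ℕ → ℕ) (d i : ℕ) : (towerCost p M (p ^ i * d) : ℝ) ≤
    440 * ((p : ℝ) ^ (i + 1) * d * Real.logb p ((p : ℝ) ^ i * d) ^ 2 + p * M (p ^ i * d)) := by
  have h := Real.natLog_le_logb (p ^ i * d) p
  push_cast at h
  rw [towerCost]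
  push_cast
  calc (440 : ℝ) * (p * (p ^ i * d) * (Nat.log p (p ^ i * d)) ^ 2 + p * M (p ^ i * d))
      ≤ 440 * (p * (p ^ i * d) * Real.logb p ((p : ℝ) ^ i * d) ^ 2 + p * M (p ^ i * d)) := by
        gcongr
    _ = _ := by ring

variable {p : ℕ} [Fact p.Prime]

theorem adjoin_eq_top_of_pow {A : Type} [Field A] [Algebra (ZMod p) A] {y : A} {e : ℕ}
    (h : Algebra.adjoin (ZMod p) {y ^ e} = ⊤) : Algebra.adjoin (ZMod p) {y} = ⊤ := by
  rw [← top_le_iff, ← h]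
  refine Algebra.adjoin_le ?_
  rintro _ rfl
  exact pow_mem (Algebra.self_mem_adjoin_singleton _ _) _

theorem exists_polynomial_inverse_derivative {F : (ZMod p)[X]} (hF : F.Separable) (hm : F.Monic)
    {N : ℕ} (hN : F.natDegree = N) :
    ∃ g : (ZMod p)[X], g.degree < N ∧ F ∣ g * derivative F - 1 := by
  obtain ⟨a, b, hab⟩ := hF
  refine ⟨b %ₘ F, ?_, ⟨-a - (b /ₘ F) * derivative F, ?_⟩⟩
  · have := degree_modByMonic_lt b hm
    rwa [degree_eq_natDegree hm.ne_zero, hN] at this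
  · rw [modByMonic_eq_sub_mul_div]
    linear_combination hab

theorem aeval_polyOf {A : Type} [CommRing A] [Algebra (ZMod p) A] {n : ℕ} (y : A)
    (a : Fin n → ZMod p) : aeval y (polyOf a) = ∑ k, a k • y ^ (k : ℕ) := by
  simp [polyOf, map_sum, Algebra.smul_def]

theorem gammaExp_pos (d i : ℕ) : 0 < gammaExp p d i := by
  have := (Fact.out : p.Prime).two_le
  rw [gammaExp]
  split_ifs <;> omega

theorem gammaExp_le (d i : ℕ) : gammaExp p d i ≤ 2 * p - 1 := by
  have := (Fact.out : p.Prime).two_le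
  rw [gammaExp]
  split_ifs <;> omega

/-- Everything is transported to the field B: the two bases are the powers of x and the product
basis of the tower, so equality of coordinates reduces to equality of two expressions for one
element of B. -/
theorem programs_correct {d j : ℕ} {Q₀ : (ZMod p)[X]} (hQ : Irreducible Q₀)
    (hd : Q₀.natDegree = d)
    (htr : Algebra.trace (ZMod p) (AdjoinRoot Q₀) (AdjoinRoot.root Q₀) ≠ 0)
    (pushDown : SLP (ZMod p) (Fin (p ^ (j + 1) * d) ⊕ PreIndex p (p ^ j * d) (p ^ (j + 1) * d))
      (Fin (p ^ j * d) × Fin p))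
    (liftUp : SLP (ZMod p) ((Fin (p ^ j * d) × Fin p) ⊕
      PreIndex p (p ^ j * d) (p ^ (j + 1) * d)) (Fin (p ^ (j + 1) * d)))
    (hpush : ∀ (c : Fin (p ^ (j + 1) * d) → ZMod p)
      (t : PreIndex p (p ^ j * d) (p ^ (j + 1) * d) → ZMod p), ∃ W : Fin p → (ZMod p)[X],
        polyOf c = baseEval W ∧ ∀ ab, pushDown.eval (Sum.elim c t) ab =
          (expand (ZMod p) (gammaExp p d j) (W ab.2) %ₘ
            (X ^ (p ^ j * d) + polyOf fun a => t (.lowerPoly a))).coeff ab.1)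
    (hlift : ∀ (c : Fin (p ^ j * d) × Fin p → ZMod p)
      (t : PreIndex p (p ^ j * d) (p ^ (j + 1) * d) → ZMod p), ∃ f : (ZMod p)[X],
        IsLiftUp (p ^ j * d) (gammaExp p d j) (X ^ (p ^ j * d) + polyOf fun a => t (.lowerPoly a))
          (X ^ (p ^ (j + 1) * d) + polyOf fun a => t (.upperPoly a))
          (polyOf fun a => t (.derivInv a)) (fun b : Fin p => polyOf fun a => c (a, b)) f ∧
        ∀ k : Fin (p ^ (j + 1) * d), liftUp.eval (Sum.elim c t) k = f.coeff k) :
    ∃ (basisC : Module.Basis (Fin (p ^ (j + 1) * d)) (ZMod p) (Level p Q₀ (j + 1)))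
      (basisD : Module.Basis (Fin (p ^ j * d) × Fin p) (ZMod p) (Level p Q₀ (j + 1)))
      (t : PreIndex p (p ^ j * d) (p ^ (j + 1) * d) → ZMod p),
      (∀ a, basisC a = topGen p Q₀ (j + 1) ^ (a : ℕ)) ∧
      (∀ ab, basisD ab =
        prevGen p Q₀ (j + 1) ^ (ab.1 : ℕ) * topGen p Q₀ (j + 1) ^ (ab.2 : ℕ)) ∧
      IsPrecomputed p d Q₀ (j + 1) t ∧
      ∀ v : Level p Q₀ (j + 1),
        pushDown.eval (Sum.elim (basisC.repr v) t) = basisD.repr v ∧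
        liftUp.eval (Sum.elim (basisD.repr v) t) = basisC.repr v := by
  have hp : p.Prime := Fact.out
  obtain ⟨A, _, _, φ, hA⟩ := exists_isLevelField hQ htr j
  obtain ⟨B, _, _, _, _, ψ, pb, hB, hgen, hmap, hmin⟩ := hA.exists_succ
  have := hA.finite
  have := hB.finite
  set y := φ (topGen p Q₀ j) with hy
  set x := pb.gen with hx
  rw [hd] at hmin
  set n := p ^ j * d with hn
  set N := p ^ (j + 1) * d with hN
  set e := gammaExp p d j with he
  have hNn : N = p * n := by rw [hN, hn]; ring
  have hAn : Module.finrank (ZMod p) A = n := by rw [hA.finrank, hd]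
  have hBN : Module.finrank (ZMod p) B = N := by rw [hB.finrank, hd]
  have hzt : Algebra.adjoin (ZMod p) {y ^ e} = ⊤ := by
    have := hA.adjoin
    rwa [hd] at this
  have hyt : Algebra.adjoin (ZMod p) {y} = ⊤ := adjoin_eq_top_of_pow hzt
  have hxt : Algebra.adjoin (ZMod p) {x} = ⊤ := by
    have := adjoin_eq_top_of_pow hB.adjoin
    rwa [← hgen] at this
  have hyint : IsIntegral (ZMod p) y := Algebra.IsIntegral.isIntegral y
  have hxint : IsIntegral (ZMod p) x := Algebra.IsIntegral.isIntegral x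
  have hxz : x ^ p - x = algebraMap A B (y ^ e) := by
    have := minpoly.aeval A x
    simp only [hmin, map_sub, map_pow, aeval_X, aeval_C] at this
    rw [map_pow]
    linear_combination this
  let pbC := PowerBasis.ofAdjoinEqTop hxint hxt
  have hpbC : pbC.gen = x := PowerBasis.ofAdjoinEqTop_gen hxint hxt
  have hC : pbC.dim = N := by rw [← pbC.finrank, hBN]
  let pbA := PowerBasis.ofAdjoinEqTop hyint hyt
  have hpbA : pbA.gen = y := PowerBasis.ofAdjoinEqTop_gen hyint hyt
  have hA' : pbA.dim = n := by rw [← pbA.finrank, hAn]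
  have hB' : pb.dim = p := by
    rw [← pb.natDegree_minpoly, hmin, (artinSchreier_monic hp.one_lt (y ^ e)).2]
  let basisC : Module.Basis (Fin N) (ZMod p) (Level p Q₀ (j + 1)) :=
    (pbC.basis.reindex (finCongr hC)).map ψ.symm.toLinearEquiv
  let basisD : Module.Basis (Fin n × Fin p) (ZMod p) (Level p Q₀ (j + 1)) :=
    ((pbA.basis.smulTower pb.basis).reindex ((finCongr hA').prodCongr (finCongr hB'))).map
      ψ.symm.toLinearEquiv
  have hbC : ∀ a, basisC a = ψ.symm (x ^ (a : ℕ)) := by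
    intro a
    simp [basisC, hpbC]
  have hbD : ∀ ab, basisD ab = ψ.symm (algebraMap A B (y ^ (ab.1 : ℕ)) * x ^ (ab.2 : ℕ)) := by
    rintro ⟨a, b⟩
    simp [basisD, hpbA, Algebra.smul_def, Module.Basis.smulTower_apply, hx]
  have hsC : ∀ c, ψ (basisC.equivFun.symm c) = aeval x (polyOf c) := by
    intro c
    rw [Module.Basis.equivFun_symm_apply, map_sum, aeval_polyOf]
    refine Finset.sum_congr rfl fun k _ => ?_
    rw [map_smul, hbC, AlgEquiv.apply_symm_apply]
  have hsD : ∀ c, ψ (basisD.equivFun.symm c) =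
      ∑ b : Fin p, algebraMap A B (aeval y (polyOf fun a => c (a, b))) * x ^ (b : ℕ) := by
    intro c
    rw [Module.Basis.equivFun_symm_apply, map_sum, Fintype.sum_prod_type, Finset.sum_comm]
    refine Finset.sum_congr rfl fun b _ => ?_
    rw [aeval_polyOf, map_sum, Finset.sum_mul]
    refine Finset.sum_congr rfl fun a _ => ?_
    rw [map_smul, hbD, AlgEquiv.apply_symm_apply, ← smul_mul_assoc]
    exact congrArg (· * x ^ (b : ℕ))
      (map_smul (IsScalarTower.toAlgHom (ZMod p) A B) (c (a, b)) (y ^ (a : ℕ))).symm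
  have hlow : topMinpoly p Q₀ j = minpoly (ZMod p) y := (minpoly.algEquiv_eq φ _).symm
  have hup : topMinpoly p Q₀ (j + 1) = minpoly (ZMod p) x := by
    rw [hgen]
    exact (minpoly.algEquiv_eq ψ _).symm
  have hlm := minpoly.monic hyint
  have hum := minpoly.monic hxint
  have hln : (minpoly (ZMod p) y).natDegree = n := (natDegree_minpoly_eq_finrank hyt).trans hAn
  have hun : (minpoly (ZMod p) x).natDegree = N := (natDegree_minpoly_eq_finrank hxt).trans hBN
  obtain ⟨g, hgN, hg⟩ := exists_polynomial_inverse_derivative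
    (Algebra.IsSeparable.isSeparable (ZMod p) x) hum hun
  let t : PreIndex p n N → ZMod p
    | .lowerPoly a => (minpoly (ZMod p) y).coeff a
    | .upperPoly a => (minpoly (ZMod p) x).coeff a
    | .derivInv a => g.coeff a
    | .trace a b => Algebra.trace (ZMod p) (Level p Q₀ (j + 1))
        (prevGen p Q₀ (j + 1) ^ (a : ℕ) * topGen p Q₀ (j + 1) ^ (b : ℕ))
  have ht1 : (X ^ n + polyOf fun a => t (.lowerPoly a)) = minpoly (ZMod p) y :=
    X_pow_add_polyOf_of_monic hlm hln
  have ht2 : (X ^ N + polyOf fun a => t (.upperPoly a)) = minpoly (ZMod p) x :=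
    X_pow_add_polyOf_of_monic hum hun
  have ht3 : (polyOf fun a => t (.derivInv a)) = g := polyOf_coeff_eq hgN
  have hprev : ψ (prevGen p Q₀ (j + 1)) = algebraMap A B y := by
    rw [hy, ← hmap, topGen, levelMap_gen]
    rfl
  refine ⟨basisC, basisD, t, fun a => ?_, fun ab => ?_, ⟨fun a => ?_, fun a => ?_, ?_,
    fun a b => rfl⟩, fun v => ⟨?_, ?_⟩⟩
  · rw [hbC, hgen, ← map_pow, AlgEquiv.symm_apply_apply]
  · rw [hbD, hgen, map_pow, ← hprev, ← map_pow, ← map_pow, ← map_mul, AlgEquiv.symm_apply_apply]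
  · change (minpoly (ZMod p) y).coeff _ = (topMinpoly p Q₀ j).coeff _
    rw [hlow]
  · rw [hup]
  · rw [ht3, hup]
    exact hg
  · obtain ⟨W, hW, hWe⟩ := hpush (basisC.repr v) t
    rw [ht1] at hWe
    have hv : ψ v = aeval x (baseEval W) := by
      rw [← hW, ← hsC]
      congr 1
      exact (basisC.equivFun.symm_apply_apply v).symm
    change _ = basisD.equivFun v
    rw [← LinearEquiv.symm_apply_eq]
    apply ψ.injective
    rw [hsD, hv, aeval_pushDown hxz]
    refine Finset.sum_congr rfl fun b _ => ?_
    congr 3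
    rw [← polyOf_coeff_eq (n := n) (f := expand (ZMod p) e (W b) %ₘ minpoly (ZMod p) y) (by
      have := degree_modByMonic_lt (expand (ZMod p) e (W b)) hlm
      rwa [degree_eq_natDegree hlm.ne_zero, hln] at this)]
    congr 1
    funext a
    exact hWe (a, b)
  · obtain ⟨f, hf, hfe⟩ := hlift (basisD.repr v) t
    rw [ht1, ht2, ht3] at hf
    obtain ⟨h1, h2⟩ := hf.aeval_eq hmin hyt hzt hxt hAn (gammaExp_pos d j) hg
    rw [← hNn] at h1
    have hv : ψ v = aeval x f := by
      rw [h2, ← hsD]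
      congr 1
      exact (basisD.equivFun.symm_apply_apply v).symm
    change _ = basisC.equivFun v
    rw [← LinearEquiv.symm_apply_eq]
    apply ψ.injective
    rw [hsC, hv, ← polyOf_coeff_eq h1]
    congr 2
    funext k
    exact hfe k

/-- Superlinearity: p M(N) ≤ M(pN) follows from the monotonicity of M(n)/n, and the logarithm does
not decrease. -/
theorem mul_towerCost_le {M : ℕ → ℕ} (hM : IsMulFunction (ZMod p) M) {N : ℕ} (hN : 0 < N) :
    p * towerCost p M N ≤ towerCost p M (p * N) := by
  have hp : p.Prime := Fact.out
  have h1 : p * M N ≤ M (p * N) := (hM.mulCost (ι := Unit)).mul_le_apply hN hp.pos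
  have h2 : Nat.log p N ≤ Nat.log p (p * N) :=
    Nat.log_mono_right (Nat.le_mul_of_pos_left _ hp.pos)
  calc p * towerCost p M N = 440 * (p * (p * N) * Nat.log p N ^ 2 + p * (p * M N)) := by
        rw [towerCost]; ring
    _ ≤ 440 * (p * (p * N) * Nat.log p (p * N) ^ 2 + p * M (p * N)) := by gcongr
    _ = _ := rfl

end Main

end ASTower

theorem mainTheorem3 :
    ∃ K : ℝ, ∀ (p : ℕ) [Fact p.Prime] (M : ℕ → ℕ), ASTower.IsMulFunction (ZMod p) M →
      ∀ d : ℕ, 0 < d →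
      ∃ L : ℕ → ℕ,
        (∀ i : ℕ, 1 ≤ i → p * L i ≤ L (i + 1)) ∧
        (∀ i : ℕ, 1 ≤ i → (p * M (p ^ i * d) : ℝ) ≤ K * L i) ∧
        (∀ i : ℕ, 1 ≤ i → (L i : ℝ) ≤
          K * ((p : ℝ) ^ (i + 1) * d * Real.logb p ((p : ℝ) ^ i * d) ^ 2
            + p * M (p ^ i * d))) ∧
        ∀ i : ℕ, 1 ≤ i →
          ∃ (pushDown : ASTower.SLP (ZMod p)
                (Fin (p ^ i * d) ⊕ ASTower.PreIndex p (p ^ (i - 1) * d) (p ^ i * d))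
                (Fin (p ^ (i - 1) * d) × Fin p))
            (liftUp : ASTower.SLP (ZMod p)
                ((Fin (p ^ (i - 1) * d) × Fin p) ⊕
                  ASTower.PreIndex p (p ^ (i - 1) * d) (p ^ i * d))
                (Fin (p ^ i * d))),
            pushDown.cost ≤ L i ∧ liftUp.cost ≤ L i ∧
            ∀ Q₀ : Polynomial (ZMod p), Irreducible Q₀ → Q₀.natDegree = d →
              Algebra.trace (ZMod p) (AdjoinRoot Q₀) (AdjoinRoot.root Q₀) ≠ 0 →
              ∃ (basisC : Module.Basis (Fin (p ^ i * d)) (ZMod p) (ASTower.Level p Q₀ i))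
                (basisD : Module.Basis (Fin (p ^ (i - 1) * d) × Fin p) (ZMod p)
                  (ASTower.Level p Q₀ i))
                (t : ASTower.PreIndex p (p ^ (i - 1) * d) (p ^ i * d) → ZMod p),
                (∀ a, basisC a = ASTower.topGen p Q₀ i ^ (a : ℕ)) ∧
                (∀ ab, basisD ab =
                  ASTower.prevGen p Q₀ i ^ (ab.1 : ℕ) * ASTower.topGen p Q₀ i ^ (ab.2 : ℕ)) ∧
                ASTower.IsPrecomputed p d Q₀ i t ∧
                ∀ v : ASTower.Level p Q₀ i,
                  pushDown.eval (Sum.elim (basisC.repr v) t) = basisD.repr v ∧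
                  liftUp.eval (Sum.elim (basisD.repr v) t) = basisC.repr v := by
  -- 440 is the factor in `towerCost`, as the upper bound requires; for the lower bound any K ≥
  -- 1/440 would do.
  refine ⟨440, fun p _ M hM d hd => ⟨fun i => ASTower.towerCost p M (p ^ i * d), ?_, ?_, ?_, ?_⟩⟩
  · intro i _
    have hp : p.Prime := Fact.out
    have := ASTower.mul_towerCost_le hM (N := p ^ i * d) (Nat.mul_pos (pow_pos hp.pos i) hd)
    rwa [← mul_assoc, ← pow_succ'] at this
  · intro i _
    have h : p * M (p ^ i * d) ≤ 440 * ASTower.towerCost p M (p ^ i * d) := by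
      rw [ASTower.towerCost]
      nlinarith [Nat.zero_le (p * (p ^ i * d) * Nat.log p (p ^ i * d) ^ 2)]
    exact_mod_cast h
  · exact fun i _ => ASTower.towerCost_le p M d i
  · intro i hi
    obtain ⟨j, rfl⟩ : ∃ j, i = j + 1 := ⟨i - 1, by omega⟩
    have hp : p.Prime := Fact.out
    have hn : 0 < p ^ j * d := Nat.mul_pos (pow_pos hp.pos j) hd
    have hN : p ^ (j + 1) * d = p * (p ^ j * d) := by ring
    obtain ⟨P, hP, hP'⟩ := ASTower.exists_pushDown_program hM hn (ASTower.gammaExp_pos d j)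
      (ASTower.gammaExp_le d j) hN
    obtain ⟨P', hP1, hP1'⟩ := ASTower.exists_liftUp_program hM hn (ASTower.gammaExp_pos d j)
      (ASTower.gammaExp_le d j) hN
    exact ⟨P, P', hP, hP1, fun Q₀ hQ hQd htr =>
      ASTower.programs_correct hQ hQd htr P P' hP' hP1'⟩
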